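/- Let $\gamma=(\gamma_1,\gamma_2):\mathbb{R}\to\mathbb{R}^2$ be a $C^2$ curve parametrized by arc length, $|\gamma'(s)|=1$ for all $s$, with image $\Gamma$. Assume that its signed curvature $k:=\gamma_1'\gamma_2''-\gamma_2'\gamma_1''$ is bounded, and that $\Gamma$ has neither self-intersections nor near-intersections: for every $\delta>0$ there is $c>0$ such that $|\gamma(s)-\gamma(s')|\ge c$ for all $s,s'\in\mathbb{R}$ with $|s-s'|\ge\delta$. Put $n(s):=(\gamma_2'(s),-\gamma_1'(s))$ and, for $\varepsilon>0$, $$\Sigma_\varepsilon:=\{\gamma(s)+u\,n(s):\ s\in\mathbb{R},\ |u|<\varepsilon\}.$$ For all sufficiently small $\varepsilon$ the pair $(s,u)$ is uniquely determined by the point $x=\gamma(s)+u\,n(s)\in\Sigma_\varepsilon$. Let $W\in L^\infty((-1,1))$ be real-valued and define for such $\varepsilon$ $$V_\varepsilon(x):=-\frac1\varepsilon\,W\!\left(\frac u\varepsilon\right)\ \text{ if } x=\gamma(s)+u\,n(s)\in\Sigma_\varepsilon,\qquad V_\varepsilon(x):=0\ \text{ if } x\notin\Sigma_\varepsilon ,$$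 and $H_\varepsilon:=-\Delta+V_\varepsilon$ on $W_{2,2}(\mathbb{R}^2)\subset L^2(\mathbb{R}^2)$. For $\alpha\in\mathbb{R}$ let $H_{\alpha,\gamma}$ (formally $-\Delta-\alpha\,\delta(x-\Gamma)$) be the operator in $L^2(\mathbb{R}^2)$ associated with the sesquilinear form $$(\psi,\phi)\mapsto\int_{\mathbb{R}^2}\overline{\nabla\psi}\cdot\nabla\phi\,dx-\alpha\int_{\mathbb{R}^2}\overline{I_m\psi}\;I_m\phi\,dm,\qquad \psi,\phi\in W_{1,2}(\mathbb{R}^2),$$ where $m$ is the one-dimensional Hausdorff measure restricted to $\Gamma$ and $I_m:W_{1,2}(\mathbb{R}^2)\to L^2(m)$ is the extension by density of the map $\psi\mapsto\psi$ on Schwartz functions. Then, with $\alpha=\int_{-1}^1W(t)\,dt$, $H_\varepsilon\to H_{\alpha,\gamma}$ in the norm-resolvent sense as $\varepsilon\to0+$: the operator $H_{\alpha,\gamma}$ and, for all sufficiently small $\varepsilon>0$, the operators $H_\varepsilon$ are self-adjoint, and for every $z\in\mathbb{C}\setminus\mathbb{R}$ $$\lim_{\varepsilon\to0+}\left\|(H_\varepsilon-z)^{-1}-(H_{\alpha,\gamma}-z)^{-1}\right\|=0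 .$$ -/

import Mathlib

open MeasureTheory Filter Topology
open scoped SchwartzMap LineDeriv Laplacian ENNReal

noncomputable section

namespace LeakyWire

/-- The Euclidean plane. -/
abbrev Plane : Type := EuclideanSpace ℝ (Fin 2)

/-- The Hilbert space `L²(ℝ²)` of complex-valued functions. -/
abbrev L2 : Type := Lp ℂ 2 (volume : Measure Plane)

/-! ### Sobolev spaces and weak derivatives -/

/-- The Sobolev space `W_{k,2}(ℝ²)`, as a subspace of `L²(ℝ²)`. -/
def sobolev (k : ℕ) : Submodule ℂ L2 where
  carrier := {ψ | TemperedDistribution.MemSobolev (k : ℝ) 2 (ψ : 𝓢'(Plane, ℂ))}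
  zero_mem' := by
    have h := TemperedDistribution.memSobolev_fun_zero Plane ℂ (k : ℝ) 2
    rwa [← map_zero (Lp.toTemperedDistributionCLM ℂ (volume : Measure Plane) 2)] at h
  add_mem' {ψ φ} hψ hφ := by
    have h := TemperedDistribution.MemSobolev.add hψ hφ
    rwa [← Lp.toTemperedDistributionCLM_apply ψ, ← Lp.toTemperedDistributionCLM_apply φ,
      ← map_add] at h
  smul_mem' c ψ hψ := by
    have h := TemperedDistribution.MemSobolev.smul c hψ
    rwa [← Lp.toTemperedDistributionCLM_apply ψ, ← map_smul] at h

theorem toTemperedDistribution_injective :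
    Function.Injective (fun f : L2 => (f : 𝓢'(Plane, ℂ))) :=
  LinearMap.ker_eq_bot.mp (Lp.ker_toTemperedDistributionCLM_eq_bot (F := ℂ)
    (μ := (volume : Measure Plane)) (p := 2))

theorem exists_partialDeriv (i : Fin 2) (ψ : sobolev 1) :
    ∃ g : L2, ∂_{EuclideanSpace.single i (1 : ℝ)} ((ψ : L2) : 𝓢'(Plane, ℂ)) =
      (g : 𝓢'(Plane, ℂ)) := by
  have h : TemperedDistribution.MemSobolev ((1 : ℕ) : ℝ) 2 ((ψ : L2) : 𝓢'(Plane, ℂ)) := ψ.2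
  have h' := h.lineDerivOp (m := EuclideanSpace.single i (1 : ℝ))
  simpa [TemperedDistribution.memSobolev_zero_iff] using h'

theorem exists_laplacian (ψ : sobolev 2) :
    ∃ g : L2, Δ ((ψ : L2) : 𝓢'(Plane, ℂ)) = (g : 𝓢'(Plane, ℂ)) := by
  have h : TemperedDistribution.MemSobolev ((2 : ℕ) : ℝ) 2 ((ψ : L2) : 𝓢'(Plane, ℂ)) := ψ.2
  have h' := h.laplacian
  simpa [TemperedDistribution.memSobolev_zero_iff] using h'

/-- The distributional partial derivative `∂ᵢ : W_{1,2}(ℝ²) → L²(ℝ²)`. -/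
def partialDeriv (i : Fin 2) : sobolev 1 →ₗ[ℂ] L2 where
  toFun ψ := (exists_partialDeriv i ψ).choose
  map_add' ψ φ := by
    apply toTemperedDistribution_injective
    change _ = Lp.toTemperedDistributionCLM ℂ (volume : Measure Plane) 2 _
    rw [map_add]
    simp only [Lp.toTemperedDistributionCLM_apply]
    rw [← (exists_partialDeriv i (ψ + φ)).choose_spec, ← (exists_partialDeriv i ψ).choose_spec,
      ← (exists_partialDeriv i φ).choose_spec, ← LineDeriv.lineDerivOp_add]
    congr 1
    exact map_add (Lp.toTemperedDistributionCLM ℂ (volume : Measure Plane) 2) (ψ : L2) φ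
  map_smul' c ψ := by
    apply toTemperedDistribution_injective
    change _ = Lp.toTemperedDistributionCLM ℂ (volume : Measure Plane) 2 _
    rw [map_smul]
    simp only [Lp.toTemperedDistributionCLM_apply, RingHom.id_apply]
    rw [← (exists_partialDeriv i (c • ψ)).choose_spec, ← (exists_partialDeriv i ψ).choose_spec,
      ← LineDeriv.lineDerivOp_smul]
    congr 1
    exact map_smul (Lp.toTemperedDistributionCLM ℂ (volume : Measure Plane) 2) c (ψ : L2)

/-- The distributional Laplacian `Δ : W_{2,2}(ℝ²) → L²(ℝ²)`. -/
def laplacianL2 : sobolev 2 →ₗ[ℂ] L2 where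
  toFun ψ := (exists_laplacian ψ).choose
  map_add' ψ φ := by
    apply toTemperedDistribution_injective
    change _ = Lp.toTemperedDistributionCLM ℂ (volume : Measure Plane) 2 _
    rw [map_add]
    simp only [Lp.toTemperedDistributionCLM_apply]
    rw [← (exists_laplacian (ψ + φ)).choose_spec, ← (exists_laplacian ψ).choose_spec,
      ← (exists_laplacian φ).choose_spec]
    simp only [← TemperedDistribution.laplacianCLM_apply]
    rw [← map_add]
    congr 1
    exact map_add (Lp.toTemperedDistributionCLM ℂ (volume : Measure Plane) 2) (ψ : L2) φ
  map_smul' c ψ := by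
    apply toTemperedDistribution_injective
    change _ = Lp.toTemperedDistributionCLM ℂ (volume : Measure Plane) 2 _
    rw [map_smul]
    simp only [Lp.toTemperedDistributionCLM_apply, RingHom.id_apply]
    rw [← (exists_laplacian (c • ψ)).choose_spec, ← (exists_laplacian ψ).choose_spec]
    simp only [← TemperedDistribution.laplacianCLM_apply]
    rw [← map_smul]
    congr 1
    exact map_smul (Lp.toTemperedDistributionCLM ℂ (volume : Measure Plane) 2) c (ψ : L2)

/-! ### Schrödinger operators with a regular potential -/

/-- The domain `W_{2,2}(ℝ²) ∩ {ψ : V ψ ∈ L²(ℝ²)}` of the operator sum `-Δ + V`; it is all of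
`W_{2,2}(ℝ²)` if `V` is essentially bounded. -/
def schrodingerDomain (V : Plane → ℝ) : Submodule ℂ L2 where
  carrier := {ψ | ψ ∈ sobolev 2 ∧ MemLp (fun x => (V x : ℂ) * ψ x) 2 volume}
  zero_mem' := by
    refine ⟨zero_mem _, (MemLp.zero (ε := ℂ)).ae_eq ?_⟩
    filter_upwards [Lp.coeFn_zero ℂ 2 (volume : Measure Plane)] with x hx
    rw [hx]
    simp
  add_mem' {ψ φ} hψ hφ := by
    refine ⟨add_mem hψ.1 hφ.1, (hψ.2.add hφ.2).ae_eq ?_⟩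
    filter_upwards [Lp.coeFn_add ψ φ] with x hx
    rw [hx]
    simp only [Pi.add_apply, mul_add]
  smul_mem' c ψ hψ := by
    refine ⟨Submodule.smul_mem _ c hψ.1, (hψ.2.const_smul c).ae_eq ?_⟩
    filter_upwards [Lp.coeFn_smul c ψ] with x hx
    simp [hx, mul_left_comm]

/-- The Schrödinger operator `-Δ + V` in `L²(ℝ²)`. -/
def schrodinger (V : Plane → ℝ) : L2 →ₗ.[ℂ] L2 where
  domain := schrodingerDomain V
  toFun :=
    { toFun := fun ψ => -laplacianL2 ⟨ψ, ψ.2.1⟩ + ψ.2.2.toLp (fun x => (V x : ℂ) * (ψ : L2) x)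
      map_add' := fun ψ φ => by
        have h1 : laplacianL2 ⟨((ψ + φ : schrodingerDomain V) : L2), (ψ + φ).2.1⟩ =
            laplacianL2 ⟨ψ, ψ.2.1⟩ + laplacianL2 ⟨φ, φ.2.1⟩ := by
          rw [← map_add]; rfl
        have h2 : (ψ + φ).2.2.toLp (fun x => (V x : ℂ) * ((ψ + φ : schrodingerDomain V) : L2) x) =
            ψ.2.2.toLp (fun x => (V x : ℂ) * (ψ : L2) x) +
              φ.2.2.toLp (fun x => (V x : ℂ) * (φ : L2) x) := by
          rw [← MemLp.toLp_add, MemLp.toLp_eq_toLp_iff]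
          filter_upwards [Lp.coeFn_add (ψ : L2) φ] with x hx
          rw [Submodule.coe_add, hx]
          simp only [Pi.add_apply, mul_add]
        rw [h1, h2]
        abel
      map_smul' := fun c ψ => by
        have h1 : laplacianL2 ⟨((c • ψ : schrodingerDomain V) : L2), (c • ψ).2.1⟩ =
            c • laplacianL2 ⟨ψ, ψ.2.1⟩ := by
          rw [← map_smul]; rfl
        have h2 : (c • ψ).2.2.toLp (fun x => (V x : ℂ) * ((c • ψ : schrodingerDomain V) : L2) x) =
            c • ψ.2.2.toLp (fun x => (V x : ℂ) * (ψ : L2) x) := by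
          rw [← MemLp.toLp_const_smul, MemLp.toLp_eq_toLp_iff]
          filter_upwards [Lp.coeFn_smul c (ψ : L2)] with x hx
          simp [hx, mul_left_comm]
        rw [h1, h2]
        simp }

/-! ### The singular operator `-Δ - α m` for a measure `m` -/

/-- `IsTrace m ψ g` says that `g = I_m ψ`, where `I_m : W_{1,2}(ℝ²) → L²(m)` is the extension by
density of the identity map on Schwartz functions: some sequence of Schwartz functions converges
to `ψ` in `W_{1,2}(ℝ²)` and to `g` in `L²(m)`. -/
def IsTrace (m : Measure Plane) (ψ : sobolev 1) (g : Lp ℂ 2 m) : Prop :=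
  ∃ φ : ℕ → 𝓢(Plane, ℂ),
    Tendsto (fun n => (φ n).toLp 2 volume) atTop (𝓝 (ψ : L2)) ∧
    (∀ i : Fin 2, Tendsto (fun n => (∂_{EuclideanSpace.single i (1 : ℝ)} (φ n)).toLp 2 volume)
      atTop (𝓝 (partialDeriv i ψ))) ∧
    Tendsto (fun n => eLpNorm (fun x => φ n x - g x) 2 m) atTop (𝓝 0)

theorem IsTrace.add {m : Measure Plane} {ψ₁ ψ₂ : sobolev 1} {g₁ g₂ : Lp ℂ 2 m}
    (h₁ : IsTrace m ψ₁ g₁) (h₂ : IsTrace m ψ₂ g₂) : IsTrace m (ψ₁ + ψ₂) (g₁ + g₂) := by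
  obtain ⟨φ₁, a₁, b₁, c₁⟩ := h₁
  obtain ⟨φ₂, a₂, b₂, c₂⟩ := h₂
  refine ⟨fun n => φ₁ n + φ₂ n, a₁.add a₂, fun i => ?_, ?_⟩
  · rw [map_add]
    refine ((b₁ i).add (b₂ i)).congr fun n => ?_
    rw [LineDeriv.lineDerivOp_add]
    rfl
  · have h := c₁.add c₂
    rw [add_zero] at h
    refine tendsto_of_tendsto_of_tendsto_of_le_of_le tendsto_const_nhds h
      (fun _ => zero_le) fun n => ?_
    have e : eLpNorm (fun x => (φ₁ n + φ₂ n) x - (g₁ + g₂ : Lp ℂ 2 m) x) 2 m =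
        eLpNorm ((fun x => φ₁ n x - g₁ x) + fun x => φ₂ n x - g₂ x) 2 m := by
      refine eLpNorm_congr_ae ?_
      filter_upwards [Lp.coeFn_add g₁ g₂] with x hx
      simp only [hx, Pi.add_apply, add_apply]
      ring
    change eLpNorm (fun x => (φ₁ n + φ₂ n) x - (g₁ + g₂ : Lp ℂ 2 m) x) 2 m ≤ _
    rw [e]
    exact eLpNorm_add_le
      ((φ₁ n).continuous.aestronglyMeasurable.sub (Lp.aestronglyMeasurable g₁))
      ((φ₂ n).continuous.aestronglyMeasurable.sub (Lp.aestronglyMeasurable g₂)) (by norm_num)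

theorem IsTrace.smul {m : Measure Plane} {ψ : sobolev 1} {g : Lp ℂ 2 m} (c : ℂ)
    (h : IsTrace m ψ g) : IsTrace m (c • ψ) (c • g) := by
  obtain ⟨φ, a, b, d⟩ := h
  refine ⟨fun n => c • φ n, a.const_smul c, fun i => ?_, ?_⟩
  · rw [map_smul]
    refine ((b i).const_smul c).congr fun n => ?_
    rw [LineDeriv.lineDerivOp_smul]
    rfl
  · have h := ENNReal.Tendsto.const_mul d (Or.inr (enorm_ne_top (x := c)))
    rw [mul_zero] at h
    refine h.congr fun n => ?_
    rw [← eLpNorm_const_smul]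
    refine eLpNorm_congr_ae ?_
    filter_upwards [Lp.coeFn_smul c g] with x hx
    simp [hx, mul_sub]

theorem IsTrace.zero (m : Measure Plane) : IsTrace m 0 0 := by
  refine ⟨fun _ => 0, ?_, fun i => ?_, ?_⟩
  · exact tendsto_const_nhds
  · rw [map_zero]
    refine tendsto_const_nhds.congr fun n => ?_
    rw [LineDeriv.lineDerivOp_zero]
    rfl
  · refine tendsto_const_nhds.congr fun n => ?_
    rw [← eLpNorm_zero (ε := ℂ) (p := 2) (μ := m)]
    refine eLpNorm_congr_ae ?_
    filter_upwards [Lp.coeFn_zero ℂ 2 m] with x hx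
    rw [hx]
    simp

/-- The value `∫ conj(∇φ) · ∇ψ dx - α ∫ conj(h) g dm` of the sesquilinear form of `-Δ - α m` at
`(φ, ψ)`, where `h = I_m φ` and `g = I_m ψ` are the traces. -/
def singularForm (α : ℝ) (m : Measure Plane) (φ ψ : sobolev 1) (h g : Lp ℂ 2 m) : ℂ :=
  ∑ i : Fin 2, inner ℂ (partialDeriv i φ) (partialDeriv i ψ) - (α : ℂ) * inner ℂ h g

/-- The graph of the operator associated with the form of `-Δ - α m` on `W_{1,2}(ℝ²)`: the pairs
`(ψ, η)` with `ψ ∈ W_{1,2}(ℝ²)` such that the form at `(φ, ψ)` is `⟨φ, η⟩` for all `φ`. -/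
def singularGraph (α : ℝ) (m : Measure Plane) : Submodule ℂ (L2 × L2) where
  carrier := {p | ∃ (ψ : sobolev 1) (g : Lp ℂ 2 m), (ψ : L2) = p.1 ∧ IsTrace m ψ g ∧
    ∀ (φ : sobolev 1) (h : Lp ℂ 2 m), IsTrace m φ h →
      singularForm α m φ ψ h g = inner ℂ (φ : L2) p.2}
  zero_mem' := ⟨0, 0, rfl, IsTrace.zero m, fun φ h _ => by simp [singularForm]⟩
  add_mem' := by
    rintro _ _ ⟨ψ₁, g₁, e₁, t₁, f₁⟩ ⟨ψ₂, g₂, e₂, t₂, f₂⟩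
    refine ⟨ψ₁ + ψ₂, g₁ + g₂, by simp [e₁, e₂], t₁.add t₂, fun φ h hh => ?_⟩
    rw [Prod.snd_add, inner_add_right, ← f₁ φ h hh, ← f₂ φ h hh]
    simp only [singularForm, map_add, inner_add_right, Finset.sum_add_distrib]
    ring
  smul_mem' := by
    rintro c _ ⟨ψ, g, e, t, f⟩
    refine ⟨c • ψ, c • g, by simp [e], t.smul c, fun φ h hh => ?_⟩
    rw [Prod.smul_snd, inner_smul_right, ← f φ h hh]
    simp only [singularForm, map_smul, inner_smul_right, ← Finset.mul_sum]
    ring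

/-- The operator associated with the form of `-Δ - α m`. -/
def singularOperator (α : ℝ) (m : Measure Plane) : L2 →ₗ.[ℂ] L2 :=
  (singularGraph α m).toLinearPMap

/-! ### The curve -/

/-- The signed curvature `γ₁' γ₂'' - γ₂' γ₁''` of a curve parametrized by arc length. -/
def signedCurvature (γ : ℝ → Plane) (s : ℝ) : ℝ :=
  deriv γ s 0 * deriv (deriv γ) s 1 - deriv γ s 1 * deriv (deriv γ) s 0

/-- The unit normal `n(s) = (γ₂'(s), -γ₁'(s))`. -/
def unitNormal (γ : ℝ → Plane) (s : ℝ) : Plane :=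
  !₂[deriv γ s 1, -deriv γ s 0]

/-- An infinite planar `C²` curve parametrized by arc length, with bounded curvature, without
self-intersections and near-intersections: points of the curve whose arc-length distance is
bounded below are at a distance bounded below. -/
structure IsRegularCurve (γ : ℝ → Plane) : Prop where
  contDiff : ContDiff ℝ 2 γ
  arcLength : ∀ s, ‖deriv γ s‖ = 1
  boundedCurvature : ∃ c : ℝ, 0 < c ∧ ∀ s, |signedCurvature γ s| < c
  noNearIntersection : ∀ δ : ℝ, 0 < δ → ∃ c : ℝ, 0 < c ∧
    ∀ s s' : ℝ, δ ≤ |s - s'| → c ≤ ‖γ s - γ s'‖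

/-- The Dirac measure of the curve: the one-dimensional Hausdorff measure restricted to it. -/
def curveMeasure (γ : ℝ → Plane) : Measure Plane :=
  (Measure.hausdorffMeasure 1).restrict (Set.range γ)

/-- The operator `H_{α,γ} = -Δ - α δ(x - Γ)`. -/
def deltaOperator (α : ℝ) (γ : ℝ → Plane) : L2 →ₗ.[ℂ] L2 :=
  singularOperator α (curveMeasure γ)

open Classical in
/-- The transversally scaled potential: `V_ε(x) = -ε⁻¹ W(u/ε)` if `x = γ(s) + u n(s)` with
`|u| < ε`, and `V_ε(x) = 0` if `x` is not of this form. (For small `ε` the pair `(s, u)` is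
unique.) -/
def scaledPotential (W : ℝ → ℝ) (γ : ℝ → Plane) (ε : ℝ) (x : Plane) : ℝ :=
  if h : ∃ p : ℝ × ℝ, |p.2| < ε ∧ x = γ p.1 + p.2 • unitNormal γ p.1 then
    -(1 / ε) * W (h.choose.2 / ε)
  else 0

/-! ### Norm-resolvent convergence -/

/-- `R` is the resolvent `(A - z)⁻¹`, a bounded everywhere defined operator. -/
structure IsResolventAt (A : L2 →ₗ.[ℂ] L2) (z : ℂ) (R : L2 →L[ℂ] L2) : Prop where
  right_inv : ∀ f : L2, ∃ h : R f ∈ A.domain, A ⟨R f, h⟩ - z • R f = f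
  left_inv : ∀ ψ : A.domain, R (A ψ - z • (ψ : L2)) = ψ

/-- Convergence of self-adjoint operators in the norm-resolvent sense: the resolvents at every
non-real point converge in the operator norm. -/
def NormResolventTendsto {ι : Type} (A : ι → L2 →ₗ.[ℂ] L2) (l : Filter ι)
    (B : L2 →ₗ.[ℂ] L2) : Prop :=
  IsSelfAdjoint B ∧ (∀ᶠ i in l, IsSelfAdjoint (A i)) ∧
    ∀ z : ℂ, z.im ≠ 0 → ∃ (R : ι → L2 →L[ℂ] L2) (S : L2 →L[ℂ] L2),
      (∀ᶠ i in l, IsResolventAt (A i) z (R i)) ∧ IsResolventAt B z S ∧ Tendsto R l (𝓝 S)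

end LeakyWire

end

noncomputable section

namespace LeakyWire

/-! ### Self-adjoint operators given by forms -/

/-! All operators involved come from quadratic forms on the same form domain, the Hilbert space `H1`
with norm `‖ψ‖² + ‖∇ψ‖²`, embedded in `L2` by `J = H1.toL2`. If the interaction is represented by a
bounded self-adjoint operator `B` on `H1`, so that the form is `‖∇ψ‖² - ⟪ψ, B ψ⟫`, then the
resolvent is `J (1 - B - (1 + z) J* J)⁻¹ J*`. Inversion is continuous in the operator norm, so
norm-resolvent convergence follows once `B_ε → B₀` in norm on `H1` and the limiting operator is
invertible for non-real `z` (`normResolventTendsto_of_forms`). Invertibility is a coercivity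
statement (`isUnit_shiftedForm`): the trace estimate `‖I_m ψ‖² ≤ c (‖ψ‖² + ‖ψ‖ ‖ψ‖_{H1})` makes the
delta interaction form-small with respect to `-Δ`.

The norm convergence is a computation in the coordinates `x = γ(s) + u n(s)`, whose volume density
is `1 + u k(s)`. They are injective on a strip of some width `a`: locally because the curvature is
bounded, globally because there are no near-intersections. With `f = conj φ · ψ` and `α = ∫ W`, the
difference of the two forms is the integral of `ε⁻¹ W(u/ε) ((1 + u k) f(s, u) - f(s, 0))` over `|u|
< ε`. The weight is at most `C/ε` on a strip of width `2ε`, so it suffices that the remaining factor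
tends to zero in `L¹(ds)`, uniformly in `|u| < ε`. The density costs `O(ε)`. The increment of `f` is
at most an integral of `|∇f|` over the thin tube, hence by Cauchy–Schwarz at most a multiple of
`‖∇φ‖ ‖ψ‖_{L²(tube)}` plus the symmetric term. Since every parallel curve satisfies the same trace
bound, the `L²` norm over the tube is `O(√ε)` times the `H1` norm. This gives a rate `O(√ε)` in
operator norm (`norm_form_sub_le`).

The estimates are made for Schwartz functions and extended by density (`denseRange_schwartzH1`). The
form operators are identified with the given ones by `isFormOperator_deltaOperator` and, through
elliptic regularity, `isFormOperator_schrodinger`. -/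

theorem IsResolventAt.isSelfAdjoint {A : L2 →ₗ.[ℂ] L2} (hA : A.IsFormalAdjoint A) {z : ℂ}
    {R R' : L2 →L[ℂ] L2} (hR : IsResolventAt A z R)
    (hR' : IsResolventAt A (starRingEnd ℂ z) R') : IsSelfAdjoint A := by
  have shift : ∀ x y : A.domain, inner ℂ (A x - z • (x : L2)) (y : L2) =
      inner ℂ (x : L2) (A y - starRingEnd ℂ z • (y : L2)) := by
    intro x y
    rw [inner_sub_left, inner_sub_right, hA x y, inner_smul_left, inner_smul_right]
  -- If `x` is orthogonal to the domain, then `⟪R x, f⟫ = ⟪x, R' f⟫ = 0` for every `f`, so `R x = 0`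
  -- and `x = (A - z) R x = 0`.
  have hd : Dense (A.domain : Set L2) := by
    rw [Submodule.dense_iff_topologicalClosure_eq_top, Submodule.topologicalClosure_eq_top_iff,
      Submodule.eq_bot_iff]
    intro x hx
    rw [Submodule.mem_orthogonal] at hx
    obtain ⟨h, e⟩ := hR.right_inv x
    have h0 : R x = 0 := by
      refine ext_inner_right ℂ fun f => ?_
      obtain ⟨h', e'⟩ := hR'.right_inv f
      have := shift ⟨R x, h⟩ ⟨R' f, h'⟩
      rw [e, e'] at this
      rw [inner_zero_left, ← this, ← inner_conj_symm, hx _ h', map_zero]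
    have h1 : (⟨R x, h⟩ : A.domain) = 0 := Subtype.ext h0
    rw [← e, h1, A.map_zero, h0, smul_zero, sub_zero]
  rw [LinearPMap.isSelfAdjoint_def]
  refine le_antisymm ?_ (hA.le_adjoint hd)
  -- The candidate is `y' = R (A* y - z y)`. The difference `y - y'` is orthogonal to the range of
  -- `A - conj z`, which is everything because `R'` is a right inverse.
  have key : ∀ y : A.adjoint.domain, ∃ h : (y : L2) ∈ A.domain, A ⟨y, h⟩ = A.adjoint y := by
    intro y
    obtain ⟨h, e⟩ := hR.right_inv (A.adjoint y - z • (y : L2))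
    set y' := R (A.adjoint y - z • (y : L2))
    have hy : (y : L2) = y' := by
      rw [← sub_eq_zero]
      refine ext_inner_right ℂ fun f => ?_
      obtain ⟨h', e'⟩ := hR'.right_inv f
      have s := shift ⟨y', h⟩ ⟨R' f, h'⟩
      rw [e, e', inner_sub_left, LinearPMap.adjoint_isFormalAdjoint hd y ⟨R' f, h'⟩,
        inner_smul_left] at s
      rw [inner_zero_left, inner_sub_left, ← s]
      nth_rw 1 [← e']
      rw [inner_sub_right, inner_smul_right, sub_self]
    refine ⟨hy ▸ h, ?_⟩
    have h2 : (⟨(y : L2), hy ▸ h⟩ : A.domain) = ⟨y', h⟩ := Subtype.ext hy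
    rw [h2, ← sub_left_inj (a := z • y'), e, ← hy]
  refine ⟨fun y hy => (key ⟨y, hy⟩).1, fun x y hxy => ?_⟩
  obtain ⟨h, e⟩ := key x
  rw [← e]
  congr 1
  exact Subtype.ext hxy

section Forms

variable {V : Type*} [NormedAddCommGroup V] [InnerProductSpace ℂ V] [CompleteSpace V]

/-- The operator on the form domain which represents the form of `A - z`, if `⟪·, (1 - B) ·⟫` is
the form of `A + 1` and `J` embeds the form domain into `L²`. -/
def shiftedForm (J : V →L[ℂ] L2) (B : V →L[ℂ] V) (z : ℂ) : V →L[ℂ] V :=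
  1 - B - (1 + z) • (J.adjoint ∘L J)

/-- `A` is the operator associated with the form `⟪φ, (1 - B) ψ⟫ - ⟪J φ, J ψ⟫`. -/
def IsFormOperator (J : V →L[ℂ] L2) (B : V →L[ℂ] V) (A : L2 →ₗ.[ℂ] L2) : Prop :=
  ∀ ψ η : L2, (ψ, η) ∈ A.graph ↔ ∃ v : V, J v = ψ ∧ shiftedForm J B 0 v = J.adjoint η

theorem shiftedForm_apply (J : V →L[ℂ] L2) (B : V →L[ℂ] V) (z : ℂ) (v : V) :
    shiftedForm J B z v = shiftedForm J B 0 v - z • J.adjoint (J v) := by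
  simp only [shiftedForm, sub_apply, smul_apply, ContinuousLinearMap.comp_apply, add_zero,
    one_smul]
  rw [add_smul, one_smul]
  abel

/-- The resolvent of the operator associated with a form. -/
def formResolvent (J : V →L[ℂ] L2) (B : V →L[ℂ] V) (z : ℂ) : L2 →L[ℂ] L2 :=
  J ∘L Ring.inverse (shiftedForm J B z) ∘L J.adjoint

/-- The equation `(A - z) ψ = f` means exactly that `ψ = J v` with `shiftedForm J B z v = J* f`, so
inverting the shifted form solves it. -/
theorem IsFormOperator.isResolventAt {J : V →L[ℂ] L2} {B : V →L[ℂ] V} {A : L2 →ₗ.[ℂ] L2}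
    (hA : IsFormOperator J B A) {z : ℂ} (hz : IsUnit (shiftedForm J B z)) :
    IsResolventAt A z (formResolvent J B z) := by
  constructor
  · intro f
    set v := Ring.inverse (shiftedForm J B z) (J.adjoint f)
    have hv : shiftedForm J B z v = J.adjoint f :=
      DFunLike.congr_fun (Ring.mul_inverse_cancel _ hz) (J.adjoint f)
    have hg : (J v, f + z • J v) ∈ A.graph := by
      rw [hA]
      refine ⟨v, rfl, ?_⟩
      rw [shiftedForm_apply, sub_eq_iff_eq_add] at hv
      rw [hv, map_add, map_smul]
    obtain ⟨x, hx, hx'⟩ := (LinearPMap.mem_graph_iff A).1 hg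
    simp only at hx hx'
    have hm : formResolvent J B z f ∈ A.domain := by
      change J v ∈ A.domain
      rw [← hx]; exact x.2
    refine ⟨hm, ?_⟩
    have : (⟨formResolvent J B z f, hm⟩ : A.domain) = x := Subtype.ext hx.symm
    rw [this, hx']
    change f + z • J v - z • J v = f
    abel
  · intro ψ
    obtain ⟨v, hv, hv'⟩ := (hA _ _).1 (LinearPMap.mem_graph A ψ)
    have h : shiftedForm J B z v = J.adjoint (A ψ - z • (ψ : L2)) := by
      rw [shiftedForm_apply, hv', map_sub, map_smul, hv]
    change J (Ring.inverse (shiftedForm J B z) (J.adjoint (A ψ - z • (ψ : L2)))) = ψ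
    rw [← h, ← hv]
    exact congrArg J (DFunLike.congr_fun (Ring.inverse_mul_cancel _ hz) v)

theorem IsFormOperator.isFormalAdjoint {J : V →L[ℂ] L2} {B : V →L[ℂ] V} {A : L2 →ₗ.[ℂ] L2}
    (hA : IsFormOperator J B A) (hB : IsSelfAdjoint B) : A.IsFormalAdjoint A := by
  intro x y
  obtain ⟨v, hv, hv'⟩ := (hA _ _).1 (LinearPMap.mem_graph A x)
  obtain ⟨w, hw, hw'⟩ := (hA _ _).1 (LinearPMap.mem_graph A y)
  have hs : ∀ a b, inner ℂ (B a) b = inner ℂ a (B b) := hB.isSymmetric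
  rw [← hv, ← hw, ← ContinuousLinearMap.adjoint_inner_left J,
    ← ContinuousLinearMap.adjoint_inner_right J, ← hv', ← hw']
  simp [shiftedForm, inner_sub_left, inner_sub_right, hs, ContinuousLinearMap.adjoint_inner_left,
    ContinuousLinearMap.adjoint_inner_right]

/-- Coercivity: the imaginary part of the quadratic form controls `‖J v‖²`, since `B` contributes
only a real number. The rest controls `‖v‖²` up to multiples of `‖J v‖²` and `‖J v‖ ‖v‖`. The
hypothesis has no `‖v‖²` term, and this is what allows a constant `C` of any size. -/
theorem isUnit_shiftedForm {J : V →L[ℂ] L2} {B : V →L[ℂ] V} (hB : IsSelfAdjoint B) {C : ℝ}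
    (hC : ∀ v, ‖inner ℂ (B v) v‖ ≤ C * (‖J v‖ ^ 2 + ‖J v‖ * ‖v‖)) {z : ℂ} (hz : z.im ≠ 0) :
    IsUnit (shiftedForm J B z) := by
  have hδ : 0 < |z.im| := abs_pos.2 hz
  set C' := |C|
  have hC0 : 0 ≤ C' := abs_nonneg C
  set K := C' + ‖1 + z‖ + C' ^ 2 / 2
  have hK : 0 ≤ K := by positivity
  have hc : 0 < 1 / (2 * (1 + K / |z.im|)) := by positivity
  refine ContinuousLinearMap.isUnit_of_forall_le_norm_inner_map _
    (c := ⟨1 / (2 * (1 + K / |z.im|)), hc.le⟩) hc fun v => ?_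
  change ‖v‖ ^ 2 * (1 / (2 * (1 + K / |z.im|))) ≤ _
  have e : inner ℂ (shiftedForm J B z v) v =
      ((‖v‖ ^ 2 : ℝ) : ℂ) - inner ℂ (B v) v - starRingEnd ℂ (1 + z) * ((‖J v‖ ^ 2 : ℝ) : ℂ) := by
    simp only [shiftedForm, sub_apply, smul_apply, ContinuousLinearMap.comp_apply, inner_sub_left,
      inner_smul_left, ContinuousLinearMap.adjoint_inner_left, one_apply_eq_self]
    rw [inner_self_eq_norm_sq_to_K, inner_self_eq_norm_sq_to_K]
    simp
  have hreal : (inner ℂ (B v) v).im = 0 := by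
    have : starRingEnd ℂ (inner ℂ (B v) v) = inner ℂ (B v) v := by
      rw [inner_conj_symm]; exact (hB.isSymmetric v v).symm
    exact Complex.conj_eq_iff_im.1 this
  set m := ‖inner ℂ (shiftedForm J B z v) v‖
  have him : |z.im| * ‖J v‖ ^ 2 ≤ m := by
    have h := Complex.abs_im_le_norm (inner ℂ (shiftedForm J B z v) v)
    rw [e] at h
    simp only [Complex.sub_im, hreal, Complex.mul_im, Complex.conj_im, Complex.conj_re,
      Complex.ofReal_im, Complex.ofReal_re, mul_zero, Complex.add_im, Complex.one_im] at h
    rw [← e] at h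
    convert h using 1
    rw [← abs_of_nonneg (sq_nonneg ‖J v‖), ← abs_mul]
    congr 1
    rw [abs_of_nonneg (sq_nonneg ‖J v‖)]
    ring
  have hre : ‖v‖ ^ 2 - C' * (‖J v‖ ^ 2 + ‖J v‖ * ‖v‖) - ‖1 + z‖ * ‖J v‖ ^ 2 ≤ m := by
    have h1 : ‖inner ℂ (B v) v‖ ≤ C' * (‖J v‖ ^ 2 + ‖J v‖ * ‖v‖) :=
      (hC v).trans (by gcongr; exact le_abs_self C)
    have h2 : ‖((‖v‖ ^ 2 : ℝ) : ℂ)‖ ≤ m + ‖inner ℂ (B v) v‖ +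
        ‖starRingEnd ℂ (1 + z) * ((‖J v‖ ^ 2 : ℝ) : ℂ)‖ := by
      have : ((‖v‖ ^ 2 : ℝ) : ℂ) = inner ℂ (shiftedForm J B z v) v + inner ℂ (B v) v +
          starRingEnd ℂ (1 + z) * ((‖J v‖ ^ 2 : ℝ) : ℂ) := by rw [e]; ring
      rw [this]
      exact norm_add₃_le
    rw [norm_mul, RCLike.norm_conj, Complex.norm_real, Complex.norm_real, Real.norm_of_nonneg
      (by positivity), Real.norm_of_nonneg (by positivity)] at h2
    linarith
  -- Young's inequality; half of `‖v‖²` survives, which is the source of the factor 2 in the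
  -- coercivity constant and of `C' ^ 2 / 2` in `K`.
  have hq : C' * (‖J v‖ * ‖v‖) ≤ ‖v‖ ^ 2 / 2 + C' ^ 2 / 2 * ‖J v‖ ^ 2 := by
    nlinarith [sq_nonneg (‖v‖ - C' * ‖J v‖)]
  have hKm : K * ‖J v‖ ^ 2 ≤ K / |z.im| * m := by
    rw [div_mul_eq_mul_div, le_div_iff₀ hδ]
    nlinarith
  rw [mul_one_div, div_le_iff₀ (by positivity)]
  have : K * ‖J v‖ ^ 2 = C' * ‖J v‖ ^ 2 + ‖1 + z‖ * ‖J v‖ ^ 2 + C' ^ 2 / 2 * ‖J v‖ ^ 2 := by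
    simp only [K]; ring
  nlinarith

/-- Convergence of the forms in the operator norm of the form domain implies norm-resolvent
convergence. -/
theorem normResolventTendsto_of_forms {ι : Type} {l : Filter ι} {J : V →L[ℂ] L2}
    {B : ι → V →L[ℂ] V} {B₀ : V →L[ℂ] V} {A : ι → L2 →ₗ.[ℂ] L2} {A₀ : L2 →ₗ.[ℂ] L2}
    (hA₀ : IsFormOperator J B₀ A₀) (hA : ∀ᶠ i in l, IsFormOperator J (B i) (A i))
    (hB₀ : IsSelfAdjoint B₀) (hB : ∀ᶠ i in l, IsSelfAdjoint (B i))
    (hu : ∀ z : ℂ, z.im ≠ 0 → IsUnit (shiftedForm J B₀ z)) (hlim : Tendsto B l (𝓝 B₀)) :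
    NormResolventTendsto A l A₀ := by
  have hM : ∀ z, Tendsto (fun i => shiftedForm J (B i) z) l (𝓝 (shiftedForm J B₀ z)) := fun z =>
    (tendsto_const_nhds.sub hlim).sub tendsto_const_nhds
  -- The units are open, so coercivity is needed for the limit only.
  have hev : ∀ z : ℂ, z.im ≠ 0 → ∀ᶠ i in l, IsUnit (shiftedForm J (B i) z) := fun z hz =>
    (hM z).eventually (Units.isOpen.mem_nhds (hu z hz))
  have hI : Complex.I.im ≠ 0 := by simp
  have hI' : (starRingEnd ℂ Complex.I).im ≠ 0 := by simp
  refine ⟨?_, ?_, fun z hz => ⟨fun i => formResolvent J (B i) z, formResolvent J B₀ z, ?_,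
    hA₀.isResolventAt (hu z hz), ?_⟩⟩
  · exact (hA₀.isResolventAt (hu _ hI)).isSelfAdjoint (hA₀.isFormalAdjoint hB₀)
      (hA₀.isResolventAt (hu _ hI'))
  · filter_upwards [hA, hB, hev _ hI, hev _ hI'] with i h1 h2 h3 h4
    exact (h1.isResolventAt h3).isSelfAdjoint (h1.isFormalAdjoint h2) (h1.isResolventAt h4)
  · filter_upwards [hA, hev _ hz] with i h1 h2
    exact h1.isResolventAt h2
  · obtain ⟨u, hu'⟩ := hu z hz
    have h1 : Tendsto (fun i => Ring.inverse (shiftedForm J (B i) z)) l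
        (𝓝 (Ring.inverse (shiftedForm J B₀ z))) := by
      have := NormedRing.inverse_continuousAt u
      rw [hu'] at this
      exact this.tendsto.comp (hM z)
    have h2 : Continuous fun T : V →L[ℂ] V => J ∘L T ∘L J.adjoint := by fun_prop
    exact (h2.tendsto _).comp h1

end Forms

/-! ### The Sobolev space of order one as a Hilbert space -/

/-- The coordinate vectors of the plane. -/
abbrev coordVec (i : Fin 2) : Plane := EuclideanSpace.single i (1 : ℝ)

open TemperedDistribution in
theorem fourierMultiplierCLM_one_add_const_mul_norm_sq (c : ℝ) (T : 𝓢'(Plane, ℂ)) :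
    fourierMultiplierCLM ℂ (fun x : Plane => ((1 + c * ‖x‖ ^ 2 : ℝ) : ℂ)) T =
      T + c • fourierMultiplierCLM ℂ (fun x : Plane => ((‖x‖ ^ 2 : ℝ) : ℂ)) T := by
  have h : (fun x : Plane => ((1 + c * ‖x‖ ^ 2 : ℝ) : ℂ)) =
      (fun _ => (1 : ℂ)) + (c : ℂ) • fun x : Plane => ((‖x‖ ^ 2 : ℝ) : ℂ) := by
    ext x; simp
  simp only [fourierMultiplierCLM_apply]
  rw [h, smulLeftCLM_add (by fun_prop) (by fun_prop), smulLeftCLM_smul (by fun_prop)]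
  simp only [add_apply, smul_apply, smulLeftCLM_const, one_smul, FourierTransform.fourierInv_add,
    FourierTransform.fourierInv_smul, FourierTransform.fourierInv_fourier_eq]
  congr 1

open TemperedDistribution in
-- The Fourier transform uses the kernel `exp(-2πi⟨x, ξ⟩)`, so the symbol `1 + ‖ξ‖²` belongs to `1 -
-- Δ / (2π)²`.
theorem besselPotential_two_eq (T : 𝓢'(Plane, ℂ)) :
    besselPotential Plane ℂ 2 T = T - ((((2 * Real.pi) ^ 2)⁻¹ : ℝ) : ℂ) • Δ T := by
  have hc : ((((2 * Real.pi) ^ 2)⁻¹ : ℝ) : ℂ) • Δ T = ((2 * Real.pi) ^ 2)⁻¹ • Δ T := by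
    ext u; rfl
  rw [hc]
  have h := fourierMultiplierCLM_one_add_const_mul_norm_sq 1 T
  rw [laplacian_eq_fourierMultiplierCLM, besselPotential, neg_smul, smul_neg, smul_smul,
    inv_mul_cancel₀ (by positivity), sub_neg_eq_add]
  simpa using h

open TemperedDistribution in
-- The symbol `1 + (2π)² ‖ξ‖²` of `1 - Δ` annihilates `T`, and its reciprocal is again an admissible
-- multiplier.
theorem eq_zero_of_eq_laplacian {T : 𝓢'(Plane, ℂ)} (h : T = Δ T) : T = 0 := by
  have h1 := fourierMultiplierCLM_one_add_const_mul_norm_sq ((2 * Real.pi) ^ 2) T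
  have hΔ := laplacian_eq_fourierMultiplierCLM T
  rw [neg_smul] at hΔ
  rw [← neg_eq_iff_eq_neg.2 hΔ, ← h, add_neg_cancel] at h1
  -- Written with `(2π) • x`, the reciprocal is a Bessel weight composed with a dilation, which
  -- yields its temperate growth.
  have hg : (fun x : Plane => (((1 + ‖(2 * Real.pi) • x‖ ^ 2) ^ (-1 : ℝ) : ℝ) : ℂ)).HasTemperateGrowth := by
    have h0 : (fun x : Plane => (((1 + ‖x‖ ^ 2) ^ (-1 : ℝ) : ℝ) : ℂ)).HasTemperateGrowth := by
      fun_prop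
    exact h0.comp (g := fun x : Plane => (((1 + ‖x‖ ^ 2) ^ (-1 : ℝ) : ℝ) : ℂ))
      (f := fun x : Plane => (2 * Real.pi) • x) (by fun_prop)
  have h2 := fourierMultiplierCLM_fourierMultiplierCLM_apply (F := ℂ)
    (g₁ := fun x : Plane => ((1 + (2 * Real.pi) ^ 2 * ‖x‖ ^ 2 : ℝ) : ℂ)) (by fun_prop) hg T
  rw [h1, map_zero] at h2
  have h3 : ((fun x : Plane => ((1 + (2 * Real.pi) ^ 2 * ‖x‖ ^ 2 : ℝ) : ℂ)) *
      fun x : Plane => (((1 + ‖(2 * Real.pi) • x‖ ^ 2) ^ (-1 : ℝ) : ℝ) : ℂ)) = fun _ => 1 := by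
    ext x
    have hx : ‖(2 * Real.pi) • x‖ ^ 2 = (2 * Real.pi) ^ 2 * ‖x‖ ^ 2 := by
      rw [norm_smul, mul_pow _ ‖x‖, Real.norm_eq_abs, sq_abs]
    simp only [Pi.mul_apply]
    rw [hx, ← Complex.ofReal_mul, Real.rpow_neg_one,
      mul_inv_cancel₀ (by positivity), Complex.ofReal_one]
  rw [h3] at h2
  simpa using h2.symm

theorem laplacian_eq_sum_coordVec (T : 𝓢'(Plane, ℂ)) :
    Δ T = ∑ i : Fin 2, ∂_{coordVec i} (∂_{coordVec i} T) := by
  rw [TemperedDistribution.laplacian_eq_sum (EuclideanSpace.basisFun (Fin 2) ℝ)]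
  simp

/-- The complex conjugate of a Schwartz function. -/
def conjSchwartz (φ : 𝓢(Plane, ℂ)) : 𝓢(Plane, ℂ) :=
  φ.postcompCLM (𝕜 := ℝ) (Complex.conjCLE : ℂ →L[ℝ] ℂ)

theorem conjSchwartz_apply (φ : 𝓢(Plane, ℂ)) (x : Plane) :
    conjSchwartz φ x = starRingEnd ℂ (φ x) := rfl

theorem conjSchwartz_conjSchwartz (φ : 𝓢(Plane, ℂ)) : conjSchwartz (conjSchwartz φ) = φ := by
  ext x; simp [conjSchwartz_apply]

theorem lineDerivOp_conjSchwartz (v : Plane) (φ : 𝓢(Plane, ℂ)) :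
    ∂_{v} (conjSchwartz φ) = conjSchwartz (∂_{v} φ) := by
  ext x
  rw [conjSchwartz_apply, SchwartzMap.lineDerivOp_apply_eq_fderiv,
    SchwartzMap.lineDerivOp_apply_eq_fderiv]
  have h : HasFDerivAt (conjSchwartz φ)
      ((Complex.conjCLE : ℂ →L[ℝ] ℂ) ∘L fderiv ℝ φ x) x :=
    (Complex.conjCLE : ℂ →L[ℝ] ℂ).hasFDerivAt.comp x (φ.hasFDerivAt x)
  rw [h.fderiv]
  rfl

theorem inner_toLp_left (φ : 𝓢(Plane, ℂ)) (g : L2) :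
    inner ℂ (φ.toLp 2 volume : L2) g = (g : 𝓢'(Plane, ℂ)) (conjSchwartz φ) := by
  rw [Lp.toTemperedDistribution_apply, L2.inner_def]
  refine integral_congr_ae ?_
  filter_upwards [φ.coeFn_toLp 2 volume] with x hx
  rw [hx, conjSchwartz_apply, smul_eq_mul, RCLike.inner_apply, mul_comm]

theorem inner_lineDerivOp_toLp_left (v : Plane) (φ : 𝓢(Plane, ℂ)) (g : L2) :
    inner ℂ ((∂_{v} φ).toLp 2 volume : L2) g = -(∂_{v} (g : 𝓢'(Plane, ℂ))) (conjSchwartz φ) := by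
  rw [inner_toLp_left, TemperedDistribution.lineDerivOp_apply_apply, lineDerivOp_conjSchwartz,
    map_neg, neg_neg]

/-- The space of all `(ψ, ∂₀ψ, ∂₁ψ)` in `L²`, with distributional derivatives. -/
def H1 : Submodule ℂ (PiLp 2 fun _ : Option (Fin 2) => L2) where
  carrier := {v | ∀ i, ∂_{coordVec i} (v none : 𝓢'(Plane, ℂ)) = (v (some i) : 𝓢'(Plane, ℂ))}
  zero_mem' i := by
    simp only [PiLp.zero_apply, ← Lp.toTemperedDistributionCLM_apply, map_zero]
    exact LineDeriv.lineDerivOp_zero _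
  add_mem' {v w} hv hw i := by
    have h1 := hv i
    have h2 := hw i
    simp only [← Lp.toTemperedDistributionCLM_apply] at h1 h2 ⊢
    rw [PiLp.add_apply, PiLp.add_apply, map_add, map_add, LineDeriv.lineDerivOp_add, h1, h2]
  smul_mem' c v hv i := by
    have h1 := hv i
    simp only [← Lp.toTemperedDistributionCLM_apply] at h1 ⊢
    rw [PiLp.smul_apply, PiLp.smul_apply, map_smul, map_smul, LineDeriv.lineDerivOp_smul, h1]

/-- Tested against a fixed Schwartz function, the relation between a function and its weak
derivative is an equality of two continuous functionals. -/
theorem isClosed_H1 : IsClosed (H1 : Set (PiLp 2 fun _ : Option (Fin 2) => L2)) := by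
  have : (H1 : Set (PiLp 2 fun _ : Option (Fin 2) => L2)) = ⋂ (i : Fin 2) (u : 𝓢(Plane, ℂ)),
      {v | (v none : 𝓢'(Plane, ℂ)) (-∂_{coordVec i} u) = (v (some i) : 𝓢'(Plane, ℂ)) u} := by
    ext v
    simp only [Set.mem_iInter, Set.mem_ofPred_eq]
    exact ⟨fun h i u => DFunLike.congr_fun (h i) u, fun h i => DFunLike.ext _ _ (h i)⟩
  rw [this]
  have hc : ∀ u : 𝓢(Plane, ℂ), Continuous fun g : L2 => (g : 𝓢'(Plane, ℂ)) u := by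
    intro u
    have : (fun g : L2 => (g : 𝓢'(Plane, ℂ)) u) =
        fun g : L2 => inner ℂ ((conjSchwartz u).toLp 2 volume : L2) g := by
      ext g; rw [inner_toLp_left, conjSchwartz_conjSchwartz]
    rw [this]
    fun_prop
  exact isClosed_iInter fun i => isClosed_iInter fun u =>
    isClosed_eq ((hc _).comp (PiLp.continuous_apply 2 _ none))
      ((hc _).comp (PiLp.continuous_apply 2 _ (some i)))

instance : CompleteSpace H1 := isClosed_H1.completeSpace_coe

instance : Inner ℂ H1 := InnerProductSpace.toInner

/-- The component of an element of `H1`: the function itself (`none`) or a partial derivative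
(`some i`). -/
def H1.comp (j : Option (Fin 2)) : H1 →L[ℂ] L2 :=
  (PiLp.proj 2 (fun _ : Option (Fin 2) => L2) j) ∘L H1.subtypeL

/-- The embedding of `H1` into `L²`. -/
abbrev H1.toL2 : H1 →L[ℂ] L2 := H1.comp none

theorem H1.lineDerivOp_toL2 (v : H1) (i : Fin 2) :
    ∂_{coordVec i} (H1.toL2 v : 𝓢'(Plane, ℂ)) = (H1.comp (some i) v : 𝓢'(Plane, ℂ)) := v.2 i

theorem H1.inner_eq (v w : H1) : inner ℂ v w =
    inner ℂ (H1.toL2 v) (H1.toL2 w) +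
      ∑ i, inner ℂ (H1.comp (some i) v) (H1.comp (some i) w) := by
  rw [Submodule.coe_inner, PiLp.inner_apply, Fintype.sum_option]
  rfl

theorem H1.norm_comp_le (j : Option (Fin 2)) (v : H1) : ‖H1.comp j v‖ ≤ ‖v‖ :=
  PiLp.norm_apply_le (p := 2) (v : PiLp 2 fun _ : Option (Fin 2) => L2) j

theorem H1.ext_toL2 {v w : H1} (h : H1.toL2 v = H1.toL2 w) : v = w := by
  apply Subtype.ext
  apply PiLp.ext
  intro j
  cases j with
  | none => exact h
  | some i =>
    apply toTemperedDistribution_injective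
    change (H1.comp (some i) v : 𝓢'(Plane, ℂ)) = (H1.comp (some i) w : 𝓢'(Plane, ℂ))
    rw [← H1.lineDerivOp_toL2, ← H1.lineDerivOp_toL2, h]

/-- The element of `H1` given by a function with distributional derivatives in `L²`. -/
def mkH1 (ψ : L2) (g : Fin 2 → L2)
    (h : ∀ i, ∂_{coordVec i} (ψ : 𝓢'(Plane, ℂ)) = (g i : 𝓢'(Plane, ℂ))) : H1 :=
  ⟨WithLp.toLp 2 (fun j : Option (Fin 2) => j.elim ψ g), h⟩

theorem toL2_mkH1 (ψ : L2) (g : Fin 2 → L2)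
    (h : ∀ i, ∂_{coordVec i} (ψ : 𝓢'(Plane, ℂ)) = (g i : 𝓢'(Plane, ℂ))) :
    H1.toL2 (mkH1 ψ g h) = ψ := rfl

theorem comp_some_mkH1 (ψ : L2) (g : Fin 2 → L2)
    (h : ∀ i, ∂_{coordVec i} (ψ : 𝓢'(Plane, ℂ)) = (g i : 𝓢'(Plane, ℂ))) (i : Fin 2) :
    H1.comp (some i) (mkH1 ψ g h) = g i := rfl

theorem lineDerivOp_toLp (φ : 𝓢(Plane, ℂ)) (i : Fin 2) :
    ∂_{coordVec i} ((φ.toLp 2 volume : L2) : 𝓢'(Plane, ℂ)) =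
      (((∂_{coordVec i} φ).toLp 2 volume : L2) : 𝓢'(Plane, ℂ)) := by
  rw [Lp.toTemperedDistribution_toLp_eq, Lp.toTemperedDistribution_toLp_eq]
  exact TemperedDistribution.lineDerivOp_toTemperedDistributionCLM_eq φ _

/-- The embedding of the Schwartz functions into `H1`. -/
def schwartzH1 : 𝓢(Plane, ℂ) →ₗ[ℂ] H1 where
  toFun φ := mkH1 _ _ (lineDerivOp_toLp φ)
  map_add' φ χ := H1.ext_toL2 (by
    rw [map_add]; simp only [toL2_mkH1]; exact map_add (SchwartzMap.toLpCLM ℂ ℂ 2 volume) φ χ)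
  map_smul' c φ := H1.ext_toL2 (by
    rw [RingHom.id_apply, map_smul]; simp only [toL2_mkH1]
    exact map_smul (SchwartzMap.toLpCLM ℂ ℂ 2 volume) c φ)

theorem toL2_schwartzH1 (φ : 𝓢(Plane, ℂ)) : H1.toL2 (schwartzH1 φ) = φ.toLp 2 volume :=
  toL2_mkH1 _ _ (lineDerivOp_toLp φ)

theorem comp_some_schwartzH1 (φ : 𝓢(Plane, ℂ)) (i : Fin 2) :
    H1.comp (some i) (schwartzH1 φ) = (∂_{coordVec i} φ).toLp 2 volume :=
  comp_some_mkH1 _ _ (lineDerivOp_toLp φ) i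

theorem sum_inner_lineDerivOp_toLp_left (φ : 𝓢(Plane, ℂ)) (v : H1) :
    ∑ i, inner ℂ ((∂_{coordVec i} φ).toLp 2 volume : L2) (H1.comp (some i) v) =
      -(Δ (H1.toL2 v : 𝓢'(Plane, ℂ))) (conjSchwartz φ) := by
  rw [laplacian_eq_sum_coordVec]
  simp only [inner_lineDerivOp_toLp_left, Fin.sum_univ_two, H1.lineDerivOp_toL2]
  rw [add_apply]
  ring

/-- Schwartz functions are dense in `H1`. -/
theorem denseRange_schwartzH1 : DenseRange schwartzH1 := by
  change Dense ((LinearMap.range schwartzH1 : Submodule ℂ H1) : Set H1)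
  rw [Submodule.dense_iff_topologicalClosure_eq_top, Submodule.topologicalClosure_eq_top_iff,
    Submodule.eq_bot_iff]
  intro v hv
  rw [Submodule.mem_orthogonal] at hv
  refine H1.ext_toL2 ?_
  rw [map_zero]
  apply toTemperedDistribution_injective
  change (H1.toL2 v : 𝓢'(Plane, ℂ)) = Lp.toTemperedDistributionCLM ℂ (volume : Measure Plane) 2 0
  rw [map_zero]
  -- Orthogonality to all Schwartz functions in the `H1` inner product says that `v - Δ v = 0` as a
  -- distribution.
  apply eq_zero_of_eq_laplacian
  ext u
  have h := hv _ ⟨conjSchwartz u, rfl⟩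
  rw [H1.inner_eq] at h
  simp only [toL2_schwartzH1, comp_some_schwartzH1] at h
  rw [sum_inner_lineDerivOp_toLp_left, inner_toLp_left, conjSchwartz_conjSchwartz,
    add_neg_eq_zero] at h
  exact h

theorem denseRange_toL2 : DenseRange H1.toL2 := by
  have h := SchwartzMap.denseRange_toLpCLM (E := Plane) (F := ℂ) (p := 2) (μ := volume) (by simp)
  refine h.mono ?_
  rintro _ ⟨φ, rfl⟩
  exact ⟨schwartzH1 φ, toL2_schwartzH1 φ⟩

/-! ### Comparison with the Bessel potential spaces -/

theorem memSobolev_zero (g : L2) :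
    TemperedDistribution.MemSobolev 0 2 (g : 𝓢'(Plane, ℂ)) :=
  TemperedDistribution.memSobolev_zero_iff.2 ⟨g, rfl⟩

/-- The operator `1 - Δ / (2π)²` shifts the Sobolev order by two, so it is enough to see that its
value has order `-1`. The Laplacian is a sum of first derivatives of `L²` functions. -/
theorem H1.toL2_mem_sobolev (v : H1) : H1.toL2 v ∈ sobolev 1 := by
  change TemperedDistribution.MemSobolev ((1 : ℕ) : ℝ) 2 (H1.toL2 v : 𝓢'(Plane, ℂ))
  have h0 : ((1 : ℕ) : ℝ) = 2 + (-1) := by norm_num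
  rw [h0, ← TemperedDistribution.memSobolev_besselPotential_iff, besselPotential_two_eq]
  have hd : ∀ i, TemperedDistribution.MemSobolev (-1) 2
      (∂_{coordVec i} (H1.comp (some i) v : 𝓢'(Plane, ℂ))) := fun i => by
    simpa using (memSobolev_zero (H1.comp (some i) v)).lineDerivOp (m := coordVec i)
  refine ((memSobolev_zero _).mono (by norm_num)).sub ?_
  rw [laplacian_eq_sum_coordVec, Fin.sum_univ_two, H1.lineDerivOp_toL2, H1.lineDerivOp_toL2]
  exact ((hd 0).add (hd 1)).smul _

theorem partialDeriv_spec (i : Fin 2) (ψ : sobolev 1) :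
    ∂_{coordVec i} ((ψ : L2) : 𝓢'(Plane, ℂ)) = (partialDeriv i ψ : 𝓢'(Plane, ℂ)) :=
  (exists_partialDeriv i ψ).choose_spec

theorem laplacianL2_spec (ψ : sobolev 2) :
    Δ ((ψ : L2) : 𝓢'(Plane, ℂ)) = (laplacianL2 ψ : 𝓢'(Plane, ℂ)) :=
  (exists_laplacian ψ).choose_spec

theorem partialDeriv_toL2 (i : Fin 2) (v : H1) :
    partialDeriv i ⟨H1.toL2 v, H1.toL2_mem_sobolev v⟩ = H1.comp (some i) v := by
  apply toTemperedDistribution_injective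
  exact (partialDeriv_spec i ⟨H1.toL2 v, H1.toL2_mem_sobolev v⟩).symm.trans
    (H1.lineDerivOp_toL2 v i)

theorem exists_H1_of_sobolev (ψ : sobolev 1) :
    ∃ v : H1, H1.toL2 v = ψ ∧ ∀ i, H1.comp (some i) v = partialDeriv i ψ :=
  ⟨mkH1 _ _ fun i => partialDeriv_spec i ψ, toL2_mkH1 _ _ _, comp_some_mkH1 _ _ _⟩

theorem sobolev_two_le_one : sobolev 2 ≤ sobolev 1 := fun _ h =>
  TemperedDistribution.MemSobolev.mono (s := ((2 : ℕ) : ℝ)) (by norm_num) h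

/-- Elliptic regularity, here immediate because `1 - Δ / (2π)²` is the Bessel potential of order
two. -/
theorem mem_sobolev_two_of_laplacian {ψ g : L2} (h : Δ (ψ : 𝓢'(Plane, ℂ)) = (g : 𝓢'(Plane, ℂ))) :
    ψ ∈ sobolev 2 := by
  change TemperedDistribution.MemSobolev ((2 : ℕ) : ℝ) 2 (ψ : 𝓢'(Plane, ℂ))
  have h0 : ((2 : ℕ) : ℝ) = 2 + 0 := by norm_num
  rw [h0, ← TemperedDistribution.memSobolev_besselPotential_iff, besselPotential_two_eq, h]
  exact (memSobolev_zero _).sub ((memSobolev_zero g).smul _)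

/-- The weak formulation of `-Δψ = f`. -/
theorem neg_laplacian_eq_iff (v : H1) (f : L2) :
    Δ (H1.toL2 v : 𝓢'(Plane, ℂ)) = ((-f : L2) : 𝓢'(Plane, ℂ)) ↔
      ∀ w : H1, ∑ i, inner ℂ (H1.comp (some i) w) (H1.comp (some i) v) =
        inner ℂ (H1.toL2 w) f := by
  constructor
  · intro h w
    refine denseRange_schwartzH1.induction_on (p := fun w =>
      ∑ i, inner ℂ (H1.comp (some i) w) (H1.comp (some i) v) = inner ℂ (H1.toL2 w) f) w
      (isClosed_eq (by fun_prop) (by fun_prop)) fun φ => ?_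
    simp only [comp_some_schwartzH1, toL2_schwartzH1]
    rw [sum_inner_lineDerivOp_toLp_left, h, ← inner_toLp_left, inner_neg_right, neg_neg]
  · intro h
    ext u
    have h1 := h (schwartzH1 (conjSchwartz u))
    simp only [comp_some_schwartzH1, toL2_schwartzH1] at h1
    rw [sum_inner_lineDerivOp_toLp_left, conjSchwartz_conjSchwartz, neg_eq_iff_eq_neg] at h1
    rw [h1, ← inner_neg_right, inner_toLp_left, conjSchwartz_conjSchwartz]

/-! ### Geometry of the curve -/

/-- The rotation `(v₀, v₁) ↦ (v₁, -v₀)` of the plane. -/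
def rotateCLM : Plane →L[ℝ] Plane :=
  LinearMap.toContinuousLinearMap
    { toFun := fun v => !₂[v 1, -v 0]
      map_add' := fun v w => by ext i; fin_cases i <;> simp; ring
      map_smul' := fun c v => by ext i; fin_cases i <;> simp }

theorem rotateCLM_apply (v : Plane) : rotateCLM v = !₂[v 1, -v 0] := rfl

theorem norm_sq_plane (v : Plane) : ‖v‖ ^ 2 = v 0 ^ 2 + v 1 ^ 2 := by
  rw [EuclideanSpace.norm_sq_eq]
  simp

theorem norm_rotateCLM (v : Plane) : ‖rotateCLM v‖ = ‖v‖ := by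
  rw [← sq_eq_sq₀ (norm_nonneg _) (norm_nonneg _), norm_sq_plane, norm_sq_plane, rotateCLM_apply]
  simp
  ring

theorem hasDerivAt_plane_apply {f : ℝ → Plane} {f' : Plane} {s : ℝ} (h : HasDerivAt f f' s)
    (i : Fin 2) : HasDerivAt (fun t => f t i) (f' i) s :=
  (EuclideanSpace.proj i : Plane →L[ℝ] ℝ).hasFDerivAt.comp_hasDerivAt s h

namespace IsRegularCurve

variable {γ : ℝ → Plane}

theorem hasDerivAt (hγ : IsRegularCurve γ) (s : ℝ) : HasDerivAt γ (deriv γ s) s :=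
  (hγ.contDiff.differentiable (by norm_num) s).hasDerivAt

theorem contDiff_deriv (hγ : IsRegularCurve γ) : ContDiff ℝ 1 (deriv γ) :=
  ((contDiff_succ_iff_deriv (n := 1)).1 (by exact_mod_cast hγ.contDiff)).2.2

theorem hasDerivAt_deriv (hγ : IsRegularCurve γ) (s : ℝ) : HasDerivAt (deriv γ) (deriv (deriv γ) s) s :=
  (hγ.contDiff_deriv.differentiable (by norm_num) s).hasDerivAt

theorem deriv_sq_add_sq (hγ : IsRegularCurve γ) (s : ℝ) : deriv γ s 0 ^ 2 + deriv γ s 1 ^ 2 = 1 := by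
  rw [← norm_sq_plane, hγ.arcLength, one_pow]

theorem deriv_orthogonal (hγ : IsRegularCurve γ) (s : ℝ) :
    deriv γ s 0 * deriv (deriv γ) s 0 + deriv γ s 1 * deriv (deriv γ) s 1 = 0 := by
  have h0 := (hasDerivAt_plane_apply (hγ.hasDerivAt_deriv s) 0).pow 2
  have h1 := (hasDerivAt_plane_apply (hγ.hasDerivAt_deriv s) 1).pow 2
  have h := h0.add h1
  have hc : ((fun t => deriv γ t 0) ^ 2 + (fun t => deriv γ t 1) ^ 2) = fun _ => (1 : ℝ) := by
    ext t; exact hγ.deriv_sq_add_sq t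
  rw [hc] at h
  have := h.unique (hasDerivAt_const s (1 : ℝ))
  norm_num at this
  linarith

theorem norm_unitNormal (hγ : IsRegularCurve γ) (s : ℝ) : ‖unitNormal γ s‖ = 1 :=
  (norm_rotateCLM (deriv γ s)).trans (hγ.arcLength s)

/-- The Frenet formula: `γ''` is orthogonal to the unit vector `γ'`, so its rotation is a multiple
of `γ'`. The sign convention for the normal makes the tube density `1 + u k`. -/
theorem hasDerivAt_unitNormal (hγ : IsRegularCurve γ) (s : ℝ) :
    HasDerivAt (unitNormal γ) (signedCurvature γ s • deriv γ s) s := by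
  have h : HasDerivAt (unitNormal γ) (rotateCLM (deriv (deriv γ) s)) s :=
    rotateCLM.hasFDerivAt.comp_hasDerivAt s (hγ.hasDerivAt_deriv s)
  convert h using 1
  have h1 := hγ.deriv_sq_add_sq s
  have h2 := hγ.deriv_orthogonal s
  ext i
  rw [rotateCLM_apply]
  fin_cases i
  · simp [signedCurvature]
    linear_combination (deriv (deriv γ) s 1) * h1 - (deriv γ s 1) * h2
  · simp [signedCurvature]
    linear_combination -(deriv (deriv γ) s 0) * h1 + (deriv γ s 0) * h2

theorem norm_deriv_deriv (hγ : IsRegularCurve γ) (s : ℝ) : ‖deriv (deriv γ) s‖ = |signedCurvature γ s| := by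
  have h : HasDerivAt (unitNormal γ) (rotateCLM (deriv (deriv γ) s)) s :=
    rotateCLM.hasFDerivAt.comp_hasDerivAt s (hγ.hasDerivAt_deriv s)
  rw [← norm_rotateCLM, h.unique (hγ.hasDerivAt_unitNormal s), norm_smul, hγ.arcLength, mul_one,
    Real.norm_eq_abs]

theorem continuous_signedCurvature (hγ : IsRegularCurve γ) : Continuous (signedCurvature γ) := by
  have h1 := hγ.contDiff_deriv.continuous
  have h2 : Continuous (deriv (deriv γ)) := hγ.contDiff_deriv.continuous_deriv (by norm_num)
  unfold signedCurvature
  fun_prop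

theorem injective (hγ : IsRegularCurve γ) : Function.Injective γ := by
  intro s s' h
  by_contra hne
  obtain ⟨c, hc, hc'⟩ := hγ.noNearIntersection |s - s'| (abs_pos.2 (sub_ne_zero.2 hne))
  have := hc' s s' le_rfl
  rw [h, sub_self, norm_zero] at this
  linarith

theorem measurableEmbedding (hγ : IsRegularCurve γ) : MeasurableEmbedding γ :=
  hγ.contDiff.continuous.measurableEmbedding hγ.injective

theorem norm_deriv_sub_le (hγ : IsRegularCurve γ) {K : ℝ} (hK : ∀ s, |signedCurvature γ s| ≤ K) (s t : ℝ) :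
    ‖deriv γ t - deriv γ s‖ ≤ K * |t - s| := by
  rw [← Real.norm_eq_abs]
  exact convex_univ.norm_image_sub_le_of_norm_deriv_le
    (fun x _ => (hγ.hasDerivAt_deriv x).differentiableAt)
    (fun x _ => by rw [hγ.norm_deriv_deriv]; exact hK x) trivial trivial

theorem norm_sub_le (hγ : IsRegularCurve γ) (s t : ℝ) : ‖γ t - γ s‖ ≤ |t - s| := by
  have := convex_univ.norm_image_sub_le_of_norm_deriv_le (f := γ) (C := 1) (x := s) (y := t)
    (fun x _ => (hγ.hasDerivAt x).differentiableAt) (fun x _ => (hγ.arcLength x).le) trivial trivial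
  simpa using this

/-- The mean value inequality for `σ ↦ γ σ - σ γ'(s)`, the deviation of the curve from its tangent
line, compares chord and arc length. -/
theorem le_norm_sub (hγ : IsRegularCurve γ) {K : ℝ} (hK : ∀ s, |signedCurvature γ s| ≤ K) (s t : ℝ) :
    (1 - K * |t - s|) * |t - s| ≤ ‖γ t - γ s‖ := by
  have hK0 : 0 ≤ K := (abs_nonneg _).trans (hK 0)
  have h := (convex_uIcc s t).norm_image_sub_le_of_norm_hasDerivWithin_le
    (f := fun σ => γ σ - σ • deriv γ s) (f' := fun σ => deriv γ σ - deriv γ s)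
    (C := K * |t - s|) (x := s) (y := t)
    (fun σ _ => by
      have := (hγ.hasDerivAt σ).sub ((hasDerivAt_id σ).smul_const (deriv γ s))
      simp only [one_smul] at this
      exact this.hasDerivWithinAt)
    (fun σ hσ => (hγ.norm_deriv_sub_le hK s σ).trans (by
      gcongr 1
      exact Set.abs_sub_left_of_mem_uIcc hσ))
    Set.left_mem_uIcc Set.right_mem_uIcc
  have e : γ t - t • deriv γ s - (γ s - s • deriv γ s) = (γ t - γ s) - (t - s) • deriv γ s := by
    rw [sub_smul]; abel
  rw [e, Real.norm_eq_abs] at h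
  have h2 := norm_sub_norm_le ((t - s) • deriv γ s) (γ t - γ s)
  rw [norm_smul, hγ.arcLength, mul_one, Real.norm_eq_abs,
    norm_sub_rev (_ • _)] at h2
  linarith

/-- On short pieces the chord estimate makes the inverse of `γ` Lipschitz with constant `(1 - η)⁻¹`.
-/
theorem volume_le_hausdorffMeasure_image (hγ : IsRegularCurve γ) {K : ℝ} (hK : ∀ s, |signedCurvature γ s| ≤ K) {η r : ℝ}
    (hη : η < 1) (hr : K * r ≤ η) {B : Set ℝ} (hB : ∀ s ∈ B, ∀ t ∈ B, |t - s| ≤ r) :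
    ENNReal.ofReal (1 - η) * volume B ≤ Measure.hausdorffMeasure 1 (γ '' B) := by
  have hK0 : 0 ≤ K := (abs_nonneg _).trans (hK 0)
  have hη' : 0 < 1 - η := by linarith
  have hL : LipschitzOnWith (Real.toNNReal (1 - η)⁻¹) (Function.invFun γ) (γ '' B) := by
    refine LipschitzOnWith.of_dist_le_mul ?_
    rintro _ ⟨s, hs, rfl⟩ _ ⟨t, ht, rfl⟩
    rw [Function.leftInverse_invFun hγ.injective, Function.leftInverse_invFun hγ.injective,
      Real.coe_toNNReal _ (by positivity), inv_mul_eq_div, le_div_iff₀ hη', Real.dist_eq,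
      dist_eq_norm]
    refine le_trans ?_ (hγ.le_norm_sub hK t s)
    rw [mul_comm]
    gcongr
    exact (mul_le_mul_of_nonneg_left (hB t ht s hs) hK0).trans hr
  have h := hL.hausdorffMeasure_image_le (d := 1) zero_le_one
  rw [← Set.image_comp, Function.invFun_comp hγ.injective, Set.image_id, ENNReal.rpow_one,
    hausdorffMeasure_real] at h
  calc ENNReal.ofReal (1 - η) * volume B
      ≤ ENNReal.ofReal (1 - η) * (Real.toNNReal (1 - η)⁻¹ * Measure.hausdorffMeasure 1 (γ '' B)) := by
        gcongr
    _ = Measure.hausdorffMeasure 1 (γ '' B) := by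
        rw [← mul_assoc]
        change ENNReal.ofReal (1 - η) * ENNReal.ofReal (1 - η)⁻¹ * _ = _
        rw [← ENNReal.ofReal_mul hη'.le, mul_inv_cancel₀ hη'.ne', ENNReal.ofReal_one, one_mul]

/-- One inequality holds because `γ` is 1-Lipschitz. For the other, `A` is cut into pieces of length
at most `η / K`, on which `γ` is almost isometric, and `η → 0` after summation. -/
theorem hausdorffMeasure_image (hγ : IsRegularCurve γ) {A : Set ℝ} (hA : MeasurableSet A) :
    Measure.hausdorffMeasure 1 (γ '' A) = volume A := by
  apply le_antisymm
  · have hL : LipschitzWith 1 γ := LipschitzWith.of_dist_le_mul fun s t => by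
      rw [dist_eq_norm, Real.dist_eq, NNReal.coe_one, one_mul]
      exact hγ.norm_sub_le t s
    have := (hL.lipschitzOnWith (s := A)).hausdorffMeasure_image_le (d := 1) zero_le_one
    rwa [hausdorffMeasure_real, ENNReal.coe_one, ENNReal.one_rpow, one_mul] at this
  obtain ⟨K, hK0, hK⟩ := hγ.boundedCurvature
  have key : ∀ η : ℝ, 0 < η → η < 1 →
      ENNReal.ofReal (1 - η) * volume A ≤ Measure.hausdorffMeasure 1 (γ '' A) := by
    intro η hη0 hη
    have hr : 0 < η / K := by positivity
    set I : ℤ → Set ℝ := fun n => Set.Ico (n • (η / K)) ((n + 1) • (η / K))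
    have hI : ⋃ n, A ∩ I n = A := by
      rw [← Set.inter_iUnion, iUnion_Ico_zsmul hr, Set.inter_univ]
    have hd : Pairwise (Function.onFun Disjoint fun n => A ∩ I n) := fun m n hmn =>
      (Set.pairwise_disjoint_Ico_zsmul (η / K) hmn).mono Set.inter_subset_right Set.inter_subset_right
    have hm : ∀ n, MeasurableSet (A ∩ I n) := fun n => hA.inter measurableSet_Ico
    calc ENNReal.ofReal (1 - η) * volume A
        = ∑' n, ENNReal.ofReal (1 - η) * volume (A ∩ I n) := by
          rw [ENNReal.tsum_mul_left, ← measure_iUnion hd hm, hI]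
      _ ≤ ∑' n, Measure.hausdorffMeasure 1 (γ '' (A ∩ I n)) := by
          refine ENNReal.tsum_le_tsum fun n => hγ.volume_le_hausdorffMeasure_image
            (fun s => (hK s).le) hη (r := η / K) (by field_simp; exact le_rfl) ?_
          rintro s ⟨-, hs⟩ t ⟨-, ht⟩
          simp only [I, Set.mem_Ico, add_smul, one_smul] at hs ht
          rw [abs_le]
          constructor <;> linarith [hs.1, hs.2, ht.1, ht.2]
      _ = Measure.hausdorffMeasure 1 (γ '' A) := by
          rw [← measure_iUnion (fun m n hmn => (Set.disjoint_image_iff hγ.injective).2 (hd hmn))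
            (fun n => hγ.measurableEmbedding.measurableSet_image.2 (hm n)), ← Set.image_iUnion, hI]
  have hlim : Tendsto (fun η : ℝ => ENNReal.ofReal (1 - η) * volume A) (𝓝[>] 0)
      (𝓝 (volume A)) := by
    have h1 : Tendsto (fun η : ℝ => ENNReal.ofReal (1 - η)) (𝓝[>] 0) (𝓝 1) := by
      have : Continuous fun η : ℝ => ENNReal.ofReal (1 - η) :=
        ENNReal.continuous_ofReal.comp (by fun_prop)
      have h := this.tendsto 0
      simp only [sub_zero, ENNReal.ofReal_one] at h
      exact h.mono_left nhdsWithin_le_nhds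
    simpa using ENNReal.Tendsto.mul_const h1 (Or.inl one_ne_zero)
  refine le_of_tendsto hlim ?_
  filter_upwards [Ioo_mem_nhdsGT (show (0 : ℝ) < 1 by norm_num)] with η h
  exact key η h.1 h.2

/-- The arc length is the one-dimensional Hausdorff measure. -/
theorem curveMeasure_eq (hγ : IsRegularCurve γ) : curveMeasure γ = Measure.map γ volume := by
  ext A hA
  rw [hγ.measurableEmbedding.map_apply, curveMeasure, Measure.restrict_apply hA,
    ← Set.image_preimage_eq_inter_range,
    hγ.hausdorffMeasure_image (hγ.contDiff.continuous.measurable hA)]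

end IsRegularCurve

/-! ### Tubular coordinates -/

/-- The point with arc length `p.1` and signed distance `p.2` from the curve. -/
def tube (γ : ℝ → Plane) (p : ℝ × ℝ) : Plane := γ p.1 + p.2 • unitNormal γ p.1

/-- The strip `ℝ × (-b, b)`. -/
abbrev strip (b : ℝ) : Set (ℝ × ℝ) := Set.univ ×ˢ Set.Ioo (-b) b

/-- The Lebesgue measure of the strip `ℝ × (-b, b)`. -/
abbrev stripMeasure (b : ℝ) : Measure (ℝ × ℝ) :=
  (volume : Measure ℝ).prod (volume.restrict (Set.Ioo (-b) b))

theorem stripMeasure_eq (b : ℝ) : stripMeasure b = volume.restrict (strip b) := by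
  rw [Measure.volume_eq_prod, ← Measure.prod_restrict, Measure.restrict_univ]

/-- The volume density of tubular coordinates. -/
def tubeDensity (γ : ℝ → Plane) (p : ℝ × ℝ) : ℝ := 1 + p.2 * signedCurvature γ p.1

/-- `a` is an admissible half-width of a tube around the curve `γ`, whose curvature is at most
`K`. -/
structure IsTubeWidth (γ : ℝ → Plane) (K a : ℝ) : Prop where
  curve : IsRegularCurve γ
  curvature_le : ∀ s, |signedCurvature γ s| ≤ K
  pos : 0 < a
  mul_le : a * K ≤ 1 / 2
  injOn : Set.InjOn (tube γ) (strip a)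

theorem IsRegularCurve.continuous_tube {γ : ℝ → Plane} (hγ : IsRegularCurve γ) :
    Continuous (tube γ) := by
  have h1 := hγ.contDiff.continuous
  have h2 : Continuous (unitNormal γ) :=
    continuous_iff_continuousAt.2 fun s => (hγ.hasDerivAt_unitNormal s).continuousAt
  unfold tube
  fun_prop

theorem IsRegularCurve.exists_isTubeWidth {γ : ℝ → Plane} (hγ : IsRegularCurve γ) :
    ∃ K a, IsTubeWidth γ K a := by
  obtain ⟨K, hK0, hK⟩ := hγ.boundedCurvature
  -- Within arc length `δ` the tangent turns by at most `1/2` in norm. In the half-width, `c / 2`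
  -- excludes collisions between distant arcs and `δ` keeps the density at least `1/2`.
  set δ := 1 / (2 * K)
  have hδ : 0 < δ := by positivity
  obtain ⟨c, hc0, hc⟩ := hγ.noNearIntersection δ hδ
  have ha0 : 0 < min (c / 2) δ := lt_min (by positivity) hδ
  have haK : min (c / 2) δ * K ≤ 1 / 2 :=
    (mul_le_mul_of_nonneg_right (min_le_right _ _) hK0.le).trans (by
      simp only [δ]; field_simp; exact le_rfl)
  refine ⟨K, min (c / 2) δ, hγ, fun s => (hK s).le, ha0, haK, ?_⟩
  set a := min (c / 2) δ
  have hac : 2 * a ≤ c := by linarith [min_le_left (c / 2) δ]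
  rintro ⟨s, u⟩ ⟨-, hu⟩ ⟨t, v⟩ ⟨-, hv⟩ h
  simp only [tube, Set.mem_Ioo] at h hu hv
  have hst : |s - t| < δ := by
    by_contra hcon
    have h1 := hc s t (not_lt.1 hcon)
    have h2 : γ s - γ t = v • unitNormal γ t - u • unitNormal γ s := by
      rw [sub_eq_sub_iff_add_eq_add, h]; abel
    rw [h2] at h1
    have h3 := _root_.norm_sub_le (v • unitNormal γ t) (u • unitNormal γ s)
    rw [norm_smul, norm_smul, hγ.norm_unitNormal, hγ.norm_unitNormal, mul_one, mul_one,
      Real.norm_eq_abs, Real.norm_eq_abs] at h3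
    have := abs_lt.2 hu
    have := abs_lt.2 hv
    linarith
  -- For nearby parameters, the parallel curve at distance `v` is projected onto the tangent at `s`.
  -- The projection is strictly increasing, and it agrees at `s` and `t` because moving along the
  -- normal at `s` does not change it.
  set f : ℝ → ℝ := fun σ => inner ℝ (deriv γ s) (γ σ + v • unitNormal γ σ)
  have hf : ∀ σ, HasDerivAt f ((1 + v * signedCurvature γ σ) *
      inner ℝ (deriv γ s) (deriv γ σ)) σ := by
    intro σ
    have h1 := (hγ.hasDerivAt σ).add ((hγ.hasDerivAt_unitNormal σ).const_smul v)
    have h2 := (hasDerivAt_const σ (deriv γ s)).inner ℝ h1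
    refine h2.congr_deriv ?_
    rw [inner_zero_left, add_zero, inner_add_right, inner_smul_right, inner_smul_right]
    ring
  have hmono : StrictMonoOn f (Set.Icc (s - δ) (s + δ)) := by
    refine strictMonoOn_of_deriv_pos (convex_Icc _ _)
      (fun σ _ => (hf σ).continuousAt.continuousWithinAt) fun σ hσ => ?_
    rw [interior_Icc] at hσ
    rw [(hf σ).deriv]
    have h1 : |v * signedCurvature γ σ| ≤ 1 / 2 := by
      rw [abs_mul]
      exact (mul_le_mul (abs_lt.2 hv).le (hK σ).le (abs_nonneg _) ha0.le).trans haK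
    have h2 : |σ - s| < δ := by rw [abs_lt]; constructor <;> linarith [hσ.1, hσ.2]
    have h3 : ‖deriv γ σ - deriv γ s‖ ≤ 1 / 2 := by
      refine (hγ.norm_deriv_sub_le (fun s => (hK s).le) s σ).trans ?_
      calc K * |σ - s| ≤ K * δ := by gcongr
        _ = 1 / 2 := by simp only [δ]; field_simp
    have h4 : inner ℝ (deriv γ s) (deriv γ σ) =
        1 + inner ℝ (deriv γ s) (deriv γ σ - deriv γ s) := by
      rw [inner_sub_right, real_inner_self_eq_norm_sq, hγ.arcLength]; ring
    have h5 := abs_real_inner_le_norm (deriv γ s) (deriv γ σ - deriv γ s)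
    rw [hγ.arcLength, one_mul] at h5
    have h6 := (abs_le.1 h5).1
    have h7 := (abs_le.1 h1).1
    refine mul_pos (by linarith) (by rw [h4]; linarith)
  have hort : inner ℝ (deriv γ s) (unitNormal γ s) = 0 := by
    rw [PiLp.inner_apply]
    simp [unitNormal, Fin.sum_univ_two]
    ring
  have hfe : f s = f t := by
    have h1 : f t = inner ℝ (deriv γ s) (γ s + u • unitNormal γ s) := by
      simp only [f, h]
    rw [h1]
    simp only [f, inner_add_right, inner_smul_right, hort, mul_zero]
  have hs : s = t := by
    rw [abs_lt] at hst
    exact hmono.injOn (by constructor <;> linarith) (by constructor <;> linarith [hst.1, hst.2]) hfe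
  subst hs
  rw [add_right_inj] at h
  have hn : unitNormal γ s ≠ 0 := fun h0 => by
    have := hγ.norm_unitNormal s
    rw [h0, norm_zero] at this
    exact zero_ne_one this
  rw [smul_left_injective ℝ hn h]

/-- Cartesian coordinates as a measurable equivalence. -/
def planeEquiv : Plane ≃ᵐ ℝ × ℝ :=
  (MeasurableEquiv.toLp 2 (Fin 2 → ℝ)).symm.trans MeasurableEquiv.finTwoArrow

theorem planeEquiv_apply (x : Plane) : planeEquiv x = (x 0, x 1) := rfl

theorem measurePreserving_planeEquiv : MeasurePreserving planeEquiv volume volume :=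
  (volume_preserving_finTwoArrow ℝ).comp
    (EuclideanSpace.volume_preserving_symm_measurableEquiv_toLp (Fin 2))

/-- The derivative of tubular coordinates. -/
def tubeFDeriv (γ : ℝ → Plane) (p : ℝ × ℝ) : Plane →L[ℝ] Plane :=
  (EuclideanSpace.proj 0 : Plane →L[ℝ] ℝ).smulRight (tubeDensity γ p • deriv γ p.1) +
    (EuclideanSpace.proj 1 : Plane →L[ℝ] ℝ).smulRight (unitNormal γ p.1)

theorem IsRegularCurve.hasFDerivAt_tube {γ : ℝ → Plane} (hγ : IsRegularCurve γ) (x : Plane) :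
    HasFDerivAt (fun x => tube γ (planeEquiv x)) (tubeFDeriv γ (planeEquiv x)) x := by
  have h0 : HasFDerivAt (fun x : Plane => x 0) (EuclideanSpace.proj 0 : Plane →L[ℝ] ℝ) x :=
    (EuclideanSpace.proj 0 : Plane →L[ℝ] ℝ).hasFDerivAt
  have h1 : HasFDerivAt (fun x : Plane => x 1) (EuclideanSpace.proj 1 : Plane →L[ℝ] ℝ) x :=
    (EuclideanSpace.proj 1 : Plane →L[ℝ] ℝ).hasFDerivAt
  have h2 := (hγ.hasDerivAt (x 0)).hasFDerivAt.comp x h0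
  have h3 := (hγ.hasDerivAt_unitNormal (x 0)).hasFDerivAt.comp x h0
  have h4 := h2.add (h1.smul h3)
  refine h4.congr_fderiv ?_
  ext v : 1
  simp only [tubeFDeriv, tubeDensity, planeEquiv_apply, add_apply, smul_apply,
    ContinuousLinearMap.comp_apply, ContinuousLinearMap.smulRight_apply, Function.comp_apply,
    ContinuousLinearMap.toSpanSingleton_apply]
  module

/-- The minus sign appears because the orthonormal frame `(γ', n)` is negatively oriented. -/
theorem IsRegularCurve.det_tubeFDeriv {γ : ℝ → Plane} (hγ : IsRegularCurve γ) (p : ℝ × ℝ) :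
    (tubeFDeriv γ p).det = -tubeDensity γ p := by
  rw [ContinuousLinearMap.det, ← LinearMap.det_toMatrix (EuclideanSpace.basisFun (Fin 2) ℝ).toBasis,
    Matrix.det_fin_two]
  simp [LinearMap.toMatrix_apply, tubeFDeriv, unitNormal]
  linear_combination (-tubeDensity γ p) * hγ.deriv_sq_add_sq p.1

namespace IsTubeWidth

variable {γ : ℝ → Plane} {K a : ℝ}

theorem curvature_nonneg (h : IsTubeWidth γ K a) : 0 ≤ K :=
  (abs_nonneg _).trans (h.curvature_le 0)

theorem mono (h : IsTubeWidth γ K a) {b : ℝ} (hb : 0 < b) (hba : b ≤ a) : IsTubeWidth γ K b :=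
  ⟨h.curve, h.curvature_le, hb, (mul_le_mul_of_nonneg_right hba h.curvature_nonneg).trans h.mul_le,
    h.injOn.mono (Set.prod_mono_right (Set.Ioo_subset_Ioo (neg_le_neg hba) hba))⟩

theorem abs_tubeDensity_sub_one_le (h : IsTubeWidth γ K a) {p : ℝ × ℝ} (hp : p ∈ strip a) :
    |tubeDensity γ p - 1| ≤ a * K := by
  rw [tubeDensity, add_sub_cancel_left, abs_mul]
  exact mul_le_mul (abs_lt.2 hp.2).le (h.curvature_le _) (abs_nonneg _) h.pos.le

theorem half_le_tubeDensity (h : IsTubeWidth γ K a) {p : ℝ × ℝ} (hp : p ∈ strip a) :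
    1 / 2 ≤ tubeDensity γ p := by
  linarith [(abs_le.1 (h.abs_tubeDensity_sub_one_le hp)).1, h.mul_le]

theorem tubeDensity_le_two (h : IsTubeWidth γ K a) {p : ℝ × ℝ} (hp : p ∈ strip a) :
    tubeDensity γ p ≤ 2 := by
  linarith [(abs_le.1 (h.abs_tubeDensity_sub_one_le hp)).2, h.mul_le]

theorem measurable_tubeDensity (h : IsTubeWidth γ K a) : Measurable (tubeDensity γ) := by
  have := h.curve.continuous_signedCurvature
  have : Continuous (tubeDensity γ) := by unfold tubeDensity; fun_prop
  exact this.measurable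

theorem measurableSet_strip (b : ℝ) : MeasurableSet (strip b) :=
  MeasurableSet.univ.prod measurableSet_Ioo

theorem measurableSet_image (h : IsTubeWidth γ K a) : MeasurableSet (tube γ '' strip a) :=
  (measurableSet_strip a).image_of_continuousOn_injOn h.curve.continuous_tube.continuousOn h.injOn

/-- Change of variables to tubular coordinates. -/
theorem map_tube (h : IsTubeWidth γ K a) :
    Measure.map (tube γ) ((stripMeasure a).withDensity fun p => ENNReal.ofReal (tubeDensity γ p)) =
      volume.restrict (tube γ '' strip a) := by
  have hm : MeasurableSet (planeEquiv ⁻¹' strip a) := planeEquiv.measurable (measurableSet_strip a)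
  have himg : (fun x => tube γ (planeEquiv x)) '' (planeEquiv ⁻¹' strip a) = tube γ '' strip a := by
    rw [← Function.comp_def, Set.image_comp, Set.image_preimage_eq _ planeEquiv.surjective]
  -- The change of variables needs a map of the plane to itself, so the strip is first pulled back
  -- by Cartesian coordinates, which preserve volume.
  have h1 := map_withDensity_abs_det_fderiv_eq_addHaar (volume : Measure Plane)
    hm.nullMeasurableSet (fun x _ => (h.curve.hasFDerivAt_tube x).hasFDerivWithinAt)
    (h.injOn.comp planeEquiv.injective.injOn fun x hx => hx)
  change Measure.map (fun x => tube γ (planeEquiv x)) _ = volume.restrict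
    ((fun x => tube γ (planeEquiv x)) '' _) at h1
  rw [himg] at h1
  rw [← h1, ← Function.comp_def (tube γ) planeEquiv, ← Measure.map_map h.curve.continuous_tube.measurable
    planeEquiv.measurable]
  congr 1
  ext A hA
  rw [Measure.map_apply planeEquiv.measurable hA, withDensity_apply _ hA,
    withDensity_apply _ (planeEquiv.measurable hA), stripMeasure_eq,
    Measure.restrict_restrict hA, Measure.restrict_restrict (planeEquiv.measurable hA),
    ← Set.preimage_inter]
  have e : ∀ x, ENNReal.ofReal |(tubeFDeriv γ (planeEquiv x)).det| =
      (fun p => ENNReal.ofReal |tubeDensity γ p|) (planeEquiv x) := fun x => by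
    rw [h.curve.det_tubeFDeriv, abs_neg]
  simp only [e]
  have hmeas : Measurable fun p => ENNReal.ofReal |tubeDensity γ p| :=
    ENNReal.measurable_ofReal.comp (measurable_norm.comp h.measurable_tubeDensity)
  rw [measurePreserving_planeEquiv.setLIntegral_comp_preimage
    (hA.inter (measurableSet_strip a)) hmeas]
  refine setLIntegral_congr_fun (hA.inter (measurableSet_strip a)) fun p hp => ?_
  rw [abs_of_nonneg (by linarith [h.half_le_tubeDensity hp.2])]

theorem lintegral_tube (h : IsTubeWidth γ K a) {F : Plane → ℝ≥0∞} (hF : Measurable F) :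
    ∫⁻ x in tube γ '' strip a, F x =
      ∫⁻ p, ENNReal.ofReal (tubeDensity γ p) * F (tube γ p) ∂stripMeasure a := by
  rw [← h.map_tube, lintegral_map hF h.curve.continuous_tube.measurable]
  exact lintegral_withDensity_eq_lintegral_mul _ (ENNReal.measurable_ofReal.comp
    h.measurable_tubeDensity) (hF.comp h.curve.continuous_tube.measurable)

theorem ae_stripMeasure (b : ℝ) : ∀ᵐ p ∂stripMeasure b, p ∈ strip b := by
  rw [stripMeasure_eq]
  exact ae_restrict_mem (measurableSet_strip b)

theorem lintegral_strip_le (h : IsTubeWidth γ K a) {F : Plane → ℝ≥0∞} (hF : Measurable F) :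
    ∫⁻ p, F (tube γ p) ∂stripMeasure a ≤ 2 * ∫⁻ x in tube γ '' strip a, F x := by
  rw [h.lintegral_tube hF, ← lintegral_const_mul' _ _ (by simp)]
  refine lintegral_mono_ae ?_
  filter_upwards [ae_stripMeasure a] with p hp
  rw [← mul_assoc]
  refine le_mul_of_one_le_left zero_le ?_
  rw [show (2 : ℝ≥0∞) = ENNReal.ofReal 2 by simp, ← ENNReal.ofReal_mul (by norm_num),
    ENNReal.one_le_ofReal]
  linarith [h.half_le_tubeDensity hp]

theorem lintegral_tube_le (h : IsTubeWidth γ K a) {F : Plane → ℝ≥0∞} (hF : Measurable F) :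
    ∫⁻ x in tube γ '' strip a, F x ≤ 2 * ∫⁻ p, F (tube γ p) ∂stripMeasure a := by
  rw [h.lintegral_tube hF, ← lintegral_const_mul' _ _ (by simp)]
  refine lintegral_mono_ae ?_
  filter_upwards [ae_stripMeasure a] with p hp
  gcongr
  rw [show (2 : ℝ≥0∞) = ENNReal.ofReal 2 by simp]
  exact ENNReal.ofReal_le_ofReal (h.tubeDensity_le_two hp)

end IsTubeWidth

/-! ### Estimates in tubular coordinates -/

namespace IsTubeWidth

variable {γ : ℝ → Plane} {K a : ℝ}

theorem enorm_tube_sub_le (h : IsTubeWidth γ K a) {f : Plane → ℂ} (hf : ContDiff ℝ 1 f) (s : ℝ)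
    {u v : ℝ} (hu : u ∈ Set.Ioo (-a) a) (hv : v ∈ Set.Ioo (-a) a) :
    ‖f (tube γ (s, u)) - f (tube γ (s, v))‖ₑ ≤
      ∫⁻ w in Set.Ioo (-a) a, ‖fderiv ℝ f (tube γ (s, w))‖ₑ := by
  have hd : ∀ w, HasDerivAt (fun w => f (tube γ (s, w)))
      (fderiv ℝ f (tube γ (s, w)) (unitNormal γ s)) w := by
    intro w
    have h1 : HasDerivAt (fun w => tube γ (s, w)) (unitNormal γ s) w := by
      have := ((hasDerivAt_id w).smul_const (unitNormal γ s)).const_add (γ s)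
      rw [one_smul] at this
      exact this
    exact ((hf.differentiable one_ne_zero _).hasFDerivAt).comp_hasDerivAt w h1
  have hc : Continuous fun w => fderiv ℝ f (tube γ (s, w)) (unitNormal γ s) := by
    have h1 := hf.continuous_fderiv one_ne_zero
    have h2 := h.curve.continuous_tube
    fun_prop
  rw [← intervalIntegral.integral_eq_sub_of_hasDerivAt (fun w _ => hd w)
    (hc.intervalIntegrable v u)]
  rw [← ofReal_norm, intervalIntegral.norm_intervalIntegral_eq, ofReal_norm]
  refine (enorm_integral_le_lintegral_enorm _).trans ?_
  refine (lintegral_mono_set (t := Set.Ioo (-a) a) ?_).trans (lintegral_mono fun w => ?_)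
  · intro w hw
    rw [Set.mem_uIoc] at hw
    rcases hw with hw | hw
    · exact ⟨by linarith [hw.1, hv.1], by linarith [hw.2, hu.2]⟩
    · exact ⟨by linarith [hw.1, hu.1], by linarith [hw.2, hv.2]⟩
  · rw [← ofReal_norm, ← ofReal_norm]
    refine ENNReal.ofReal_le_ofReal ((ContinuousLinearMap.le_opNorm _ _).trans ?_)
    rw [h.curve.norm_unitNormal, mul_one]

theorem lintegral_tube_sub_le (h : IsTubeWidth γ K a) {f : Plane → ℂ} (hf : ContDiff ℝ 1 f)
    {u v : ℝ} (hu : u ∈ Set.Ioo (-a) a) (hv : v ∈ Set.Ioo (-a) a) :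
    ∫⁻ s, ‖f (tube γ (s, u)) - f (tube γ (s, v))‖ₑ ≤
      2 * ∫⁻ x in tube γ '' strip a, ‖fderiv ℝ f x‖ₑ := by
  have hm : Measurable fun x => ‖fderiv ℝ f x‖ₑ := (hf.continuous_fderiv one_ne_zero).enorm.measurable
  refine le_trans ?_ (h.lintegral_strip_le hm)
  have hm' : Measurable fun p => ‖fderiv ℝ f (tube γ p)‖ₑ :=
    hm.comp h.curve.continuous_tube.measurable
  rw [lintegral_prod _ hm'.aemeasurable]
  exact lintegral_mono fun s => h.enorm_tube_sub_le hf s hu hv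

/-- An `L¹` trace estimate, uniform over the parallel curves: the curve at height `u` is compared
with the one at height `v`, and the result is averaged over `v` in an interval of length `2a`.
Passing to Cartesian coordinates costs a factor 2. -/
theorem lintegral_enorm_tube_le (h : IsTubeWidth γ K a) {f : Plane → ℂ} (hf : ContDiff ℝ 1 f)
    {u : ℝ} (hu : u ∈ Set.Ioo (-a) a) :
    ∫⁻ s, ‖f (tube γ (s, u))‖ₑ ≤ ENNReal.ofReal (1 / a) * (∫⁻ x in tube γ '' strip a, ‖f x‖ₑ) +
      2 * ∫⁻ x in tube γ '' strip a, ‖fderiv ℝ f x‖ₑ := by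
  set D := 2 * ∫⁻ x in tube γ '' strip a, ‖fderiv ℝ f x‖ₑ
  set X := ∫⁻ s, ‖f (tube γ (s, u))‖ₑ
  have hct := h.curve.continuous_tube
  have hcf := hf.continuous
  have hm : Measurable fun x => ‖f x‖ₑ := hcf.enorm.measurable
  have h1 : ∀ v ∈ Set.Ioo (-a) a, X ≤ (∫⁻ s, ‖f (tube γ (s, v))‖ₑ) + D := by
    intro v hv
    calc X ≤ ∫⁻ s, (‖f (tube γ (s, v))‖ₑ + ‖f (tube γ (s, u)) - f (tube γ (s, v))‖ₑ) := by
          refine lintegral_mono fun s => ?_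
          have := enorm_add_le (f (tube γ (s, v))) (f (tube γ (s, u)) - f (tube γ (s, v)))
          rwa [add_sub_cancel] at this
      _ = (∫⁻ s, ‖f (tube γ (s, v))‖ₑ) + ∫⁻ s, ‖f (tube γ (s, u)) - f (tube γ (s, v))‖ₑ := by
          refine lintegral_add_left (Continuous.measurable ?_) _
          fun_prop
      _ ≤ _ := by gcongr; exact h.lintegral_tube_sub_le hf hu hv
  have h2 : X * ENNReal.ofReal (2 * a) ≤
      2 * (∫⁻ x in tube γ '' strip a, ‖f x‖ₑ) + D * ENNReal.ofReal (2 * a) := by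
    have hv : volume (Set.Ioo (-a) a) = ENNReal.ofReal (2 * a) := by
      rw [Real.volume_Ioo]; congr 1; ring
    calc X * ENNReal.ofReal (2 * a) = ∫⁻ _ in Set.Ioo (-a) a, X := by
          rw [setLIntegral_const, hv]
      _ ≤ ∫⁻ v in Set.Ioo (-a) a, ((∫⁻ s, ‖f (tube γ (s, v))‖ₑ) + D) :=
          setLIntegral_mono' measurableSet_Ioo h1
      _ = (∫⁻ v in Set.Ioo (-a) a, ∫⁻ s, ‖f (tube γ (s, v))‖ₑ) + D * ENNReal.ofReal (2 * a) := by
          rw [lintegral_add_right _ measurable_const, setLIntegral_const, hv]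
      _ = (∫⁻ p, ‖f (tube γ p)‖ₑ ∂stripMeasure a) + D * ENNReal.ofReal (2 * a) := by
          have hm' : Measurable fun p => ‖f (tube γ p)‖ₑ := hm.comp hct.measurable
          rw [lintegral_prod_symm _ hm'.aemeasurable]
      _ ≤ _ := by gcongr; exact h.lintegral_strip_le hm
  have ha := h.pos
  have hne : ENNReal.ofReal (2 * a) ≠ 0 := by simp [ha]
  have h3 : X = X * ENNReal.ofReal (2 * a) * ENNReal.ofReal (1 / (2 * a)) := by
    rw [mul_assoc, ← ENNReal.ofReal_mul (by positivity), mul_one_div_cancel (by positivity),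
      ENNReal.ofReal_one, mul_one]
  have h4 : D = D * ENNReal.ofReal (2 * a) * ENNReal.ofReal (1 / (2 * a)) := by
    rw [mul_assoc, ← ENNReal.ofReal_mul (by positivity), mul_one_div_cancel (by positivity),
      ENNReal.ofReal_one, mul_one]
  have h5 : ENNReal.ofReal (1 / a) = 2 * ENNReal.ofReal (1 / (2 * a)) := by
    rw [show (2 : ℝ≥0∞) = ENNReal.ofReal 2 by simp, ← ENNReal.ofReal_mul (by norm_num)]
    congr 1; field_simp
  rw [h3, h4, h5, mul_right_comm 2, ← add_mul]
  gcongr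

end IsTubeWidth

/-! ### Products of Schwartz functions -/

theorem lintegral_enorm_mul_enorm_le {X E F : Type*} [MeasurableSpace X] {μ : Measure X}
    [NormedAddCommGroup E] [NormedAddCommGroup F] {f : X → E} {g : X → F}
    (hf : AEStronglyMeasurable f μ) (hg : AEStronglyMeasurable g μ) :
    ∫⁻ x, ‖f x‖ₑ * ‖g x‖ₑ ∂μ ≤ eLpNorm f 2 μ * eLpNorm g 2 μ := by
  have h := ENNReal.lintegral_mul_le_Lp_mul_Lq μ Real.HolderConjugate.two_two hf.enorm hg.enorm
  rw [eLpNorm_eq_lintegral_rpow_enorm_toReal (by simp) (by simp),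
    eLpNorm_eq_lintegral_rpow_enorm_toReal (by simp) (by simp)]
  simpa using h

theorem eLpNorm_two_sq {X E : Type*} [MeasurableSpace X] {μ : Measure X} [NormedAddCommGroup E]
    (f : X → E) : eLpNorm f 2 μ ^ 2 = ∫⁻ x, ‖f x‖ₑ ^ 2 ∂μ := by
  rw [eLpNorm_eq_lintegral_rpow_enorm_toReal (by simp) (by simp)]
  simp only [ENNReal.toReal_ofNat, ENNReal.rpow_ofNat, one_div]
  rw [← ENNReal.rpow_natCast, ← ENNReal.rpow_mul]
  simp

theorem eLpNorm_eq_enorm_toL2 (φ : 𝓢(Plane, ℂ)) :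
    eLpNorm φ 2 volume = ‖H1.toL2 (schwartzH1 φ)‖ₑ := by
  rw [toL2_schwartzH1, Lp.enorm_def]
  exact eLpNorm_congr_ae (φ.coeFn_toLp 2 volume).symm

theorem enorm_comp_le (j : Option (Fin 2)) (v : H1) : ‖H1.comp j v‖ₑ ≤ ‖v‖ₑ := by
  rw [← ofReal_norm, ← ofReal_norm]
  exact ENNReal.ofReal_le_ofReal (H1.norm_comp_le j v)

theorem eLpNorm_lineDerivOp_le (φ : 𝓢(Plane, ℂ)) (i : Fin 2) :
    eLpNorm (fun x => (∂_{coordVec i} φ) x) 2 volume ≤ ‖schwartzH1 φ‖ₑ := by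
  refine le_trans (le_of_eq ?_) (enorm_comp_le (some i) (schwartzH1 φ))
  rw [comp_some_schwartzH1, Lp.enorm_def]
  exact eLpNorm_congr_ae ((∂_{coordVec i} φ).coeFn_toLp 2 volume).symm

theorem norm_fderiv_le (φ : 𝓢(Plane, ℂ)) (x : Plane) :
    ‖fderiv ℝ φ x‖ ≤ ‖(∂_{coordVec 0} φ) x‖ + ‖(∂_{coordVec 1} φ) x‖ := by
  refine ContinuousLinearMap.opNorm_le_bound _ (by positivity) fun v => ?_
  have hv : v = v 0 • coordVec 0 + v 1 • coordVec 1 := by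
    ext i; fin_cases i <;> simp
  have h0 : |v 0| ≤ ‖v‖ := PiLp.norm_apply_le v 0
  have h1 : |v 1| ≤ ‖v‖ := PiLp.norm_apply_le v 1
  rw [SchwartzMap.lineDerivOp_apply_eq_fderiv, SchwartzMap.lineDerivOp_apply_eq_fderiv]
  calc ‖fderiv ℝ φ x v‖
      = ‖v 0 • fderiv ℝ φ x (coordVec 0) + v 1 • fderiv ℝ φ x (coordVec 1)‖ := by
        conv_lhs => rw [hv]
        rw [map_add, map_smul, map_smul]
    _ ≤ |v 0| * ‖fderiv ℝ φ x (coordVec 0)‖ + |v 1| * ‖fderiv ℝ φ x (coordVec 1)‖ := by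
        refine (norm_add_le _ _).trans ?_
        rw [norm_smul, norm_smul, Real.norm_eq_abs, Real.norm_eq_abs]
    _ ≤ _ := by
        rw [add_mul, mul_comm, mul_comm |v 1|]
        gcongr

theorem eLpNorm_fderiv_le (φ : 𝓢(Plane, ℂ)) :
    eLpNorm (fderiv ℝ φ) 2 volume ≤ 2 * ‖schwartzH1 φ‖ₑ := by
  have h0 := eLpNorm_lineDerivOp_le φ 0
  have h1 := eLpNorm_lineDerivOp_le φ 1
  have hd := norm_fderiv_le φ
  set g₀ : 𝓢(Plane, ℂ) := ∂_{coordVec 0} φ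
  set g₁ : 𝓢(Plane, ℂ) := ∂_{coordVec 1} φ
  have h := eLpNorm_add_le (μ := volume) (p := 2) g₀.continuous.norm.aestronglyMeasurable
    g₁.continuous.norm.aestronglyMeasurable (by simp)
  rw [eLpNorm_norm, eLpNorm_norm] at h
  rw [two_mul]
  exact (eLpNorm_mono_real hd).trans (h.trans (add_le_add h0 h1))

/-- The product `conj φ · ψ`. -/
def conjMul (φ ψ : 𝓢(Plane, ℂ)) (x : Plane) : ℂ := starRingEnd ℂ (φ x) * ψ x

theorem enorm_conjMul (φ ψ : 𝓢(Plane, ℂ)) (x : Plane) :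
    ‖conjMul φ ψ x‖ₑ = ‖φ x‖ₑ * ‖ψ x‖ₑ := by
  rw [conjMul, enorm_mul, RCLike.enorm_conj]

theorem contDiff_conjMul (φ ψ : 𝓢(Plane, ℂ)) : ContDiff ℝ 1 (conjMul φ ψ) :=
  ((conjSchwartz φ).smooth 1).mul (ψ.smooth 1)

theorem enorm_fderiv_conjMul_le (φ ψ : 𝓢(Plane, ℂ)) (x : Plane) :
    ‖fderiv ℝ (conjMul φ ψ) x‖ₑ ≤
      ‖fderiv ℝ φ x‖ₑ * ‖ψ x‖ₑ + ‖φ x‖ₑ * ‖fderiv ℝ ψ x‖ₑ := by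
  have h1 : HasFDerivAt (conjSchwartz φ)
      ((Complex.conjCLE : ℂ →L[ℝ] ℂ) ∘L fderiv ℝ φ x) x :=
    (Complex.conjCLE : ℂ →L[ℝ] ℂ).hasFDerivAt.comp x (φ.hasFDerivAt x)
  have h2 : HasFDerivAt (conjMul φ ψ) _ x := h1.mul (ψ.hasFDerivAt x)
  have h3 : ‖(Complex.conjCLE : ℂ →L[ℝ] ℂ) ∘L fderiv ℝ φ x‖ ≤ ‖fderiv ℝ φ x‖ :=
    ContinuousLinearMap.opNorm_le_bound _ (norm_nonneg _) fun v => by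
      have : ‖(Complex.conjCLE : ℂ →L[ℝ] ℂ) (fderiv ℝ φ x v)‖ = ‖fderiv ℝ φ x v‖ :=
        RCLike.norm_conj _
      rw [ContinuousLinearMap.comp_apply, this]
      exact ContinuousLinearMap.le_opNorm _ _
  rw [h2.fderiv]
  simp only [← ofReal_norm]
  rw [← ENNReal.ofReal_mul (norm_nonneg _), ← ENNReal.ofReal_mul (norm_nonneg _),
    ← ENNReal.ofReal_add (by positivity) (by positivity)]
  refine ENNReal.ofReal_le_ofReal ((norm_add_le _ _).trans ?_)
  rw [norm_smul, norm_smul, conjSchwartz_apply, RCLike.norm_conj, add_comm, mul_comm ‖ψ x‖]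
  gcongr

theorem lintegral_enorm_fderiv_conjMul_le (φ ψ : 𝓢(Plane, ℂ)) (S : Set Plane) :
    ∫⁻ x in S, ‖fderiv ℝ (conjMul φ ψ) x‖ₑ ≤
      2 * ‖schwartzH1 φ‖ₑ * eLpNorm ψ 2 (volume.restrict S) +
        eLpNorm φ 2 (volume.restrict S) * (2 * ‖schwartzH1 ψ‖ₑ) := by
  have hφ := (φ.smooth 1).continuous_fderiv one_ne_zero
  have hψ := (ψ.smooth 1).continuous_fderiv one_ne_zero
  have hm : ∀ χ : 𝓢(Plane, ℂ), eLpNorm (fderiv ℝ χ) 2 (volume.restrict S) ≤ 2 * ‖schwartzH1 χ‖ₑ :=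
    fun χ => (eLpNorm_mono_measure _ Measure.restrict_le_self).trans (eLpNorm_fderiv_le χ)
  calc ∫⁻ x in S, ‖fderiv ℝ (conjMul φ ψ) x‖ₑ
      ≤ ∫⁻ x in S, (‖fderiv ℝ φ x‖ₑ * ‖ψ x‖ₑ + ‖φ x‖ₑ * ‖fderiv ℝ ψ x‖ₑ) :=
        lintegral_mono fun x => enorm_fderiv_conjMul_le φ ψ x
    _ = (∫⁻ x in S, ‖fderiv ℝ φ x‖ₑ * ‖ψ x‖ₑ) + ∫⁻ x in S, ‖φ x‖ₑ * ‖fderiv ℝ ψ x‖ₑ :=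
        lintegral_add_left (hφ.enorm.measurable.mul ψ.continuous.enorm.measurable) _
    _ ≤ eLpNorm (fderiv ℝ φ) 2 (volume.restrict S) * eLpNorm ψ 2 (volume.restrict S) +
        eLpNorm φ 2 (volume.restrict S) * eLpNorm (fderiv ℝ ψ) 2 (volume.restrict S) :=
        add_le_add
          (lintegral_enorm_mul_enorm_le hφ.aestronglyMeasurable ψ.continuous.aestronglyMeasurable)
          (lintegral_enorm_mul_enorm_le φ.continuous.aestronglyMeasurable hψ.aestronglyMeasurable)
    _ ≤ _ := by gcongr <;> exact hm _

theorem lintegral_enorm_conjMul_le (φ ψ : 𝓢(Plane, ℂ)) (S : Set Plane) :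
    ∫⁻ x in S, ‖conjMul φ ψ x‖ₑ ≤ ‖H1.toL2 (schwartzH1 φ)‖ₑ * ‖H1.toL2 (schwartzH1 ψ)‖ₑ := by
  simp only [enorm_conjMul]
  refine (lintegral_enorm_mul_enorm_le φ.continuous.aestronglyMeasurable
    ψ.continuous.aestronglyMeasurable).trans ?_
  rw [← eLpNorm_eq_enorm_toL2, ← eLpNorm_eq_enorm_toL2]
  gcongr <;> exact Measure.restrict_le_self

namespace IsTubeWidth

variable {γ : ℝ → Plane} {K a : ℝ}

theorem eLpNorm_restrict_le (φ : 𝓢(Plane, ℂ)) (S : Set Plane) :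
    eLpNorm φ 2 (volume.restrict S) ≤ ‖H1.toL2 (schwartzH1 φ)‖ₑ :=
  (eLpNorm_mono_measure _ Measure.restrict_le_self).trans (eLpNorm_eq_enorm_toL2 φ).le

/-- The `L¹` trace estimate for a product. The 8 is the factor 2 of that estimate times `2 + 2` from
the product rule, each gradient being bounded by two partial derivatives. -/
theorem lintegral_enorm_conjMul_tube_le (h : IsTubeWidth γ K a) (φ ψ : 𝓢(Plane, ℂ)) {u : ℝ}
    (hu : u ∈ Set.Ioo (-a) a) :
    ∫⁻ s, ‖conjMul φ ψ (tube γ (s, u))‖ₑ ≤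
      ENNReal.ofReal (1 / a + 8) * (‖schwartzH1 φ‖ₑ * ‖schwartzH1 ψ‖ₑ) := by
  refine (h.lintegral_enorm_tube_le (contDiff_conjMul φ ψ) hu).trans ?_
  have h1 := (lintegral_enorm_conjMul_le φ ψ (tube γ '' strip a)).trans
    (mul_le_mul' (enorm_comp_le none (schwartzH1 φ)) (enorm_comp_le none (schwartzH1 ψ)))
  have h2 := lintegral_enorm_fderiv_conjMul_le φ ψ (tube γ '' strip a)
  have h3 : eLpNorm φ 2 (volume.restrict (tube γ '' strip a)) ≤ ‖schwartzH1 φ‖ₑ :=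
    (eLpNorm_restrict_le φ _).trans (enorm_comp_le none _)
  have h4 : eLpNorm ψ 2 (volume.restrict (tube γ '' strip a)) ≤ ‖schwartzH1 ψ‖ₑ :=
    (eLpNorm_restrict_le ψ _).trans (enorm_comp_le none _)
  have ha := h.pos
  calc _ ≤ ENNReal.ofReal (1 / a) * (‖schwartzH1 φ‖ₑ * ‖schwartzH1 ψ‖ₑ) +
        2 * (2 * ‖schwartzH1 φ‖ₑ * ‖schwartzH1 ψ‖ₑ + ‖schwartzH1 φ‖ₑ * (2 * ‖schwartzH1 ψ‖ₑ)) := by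
        gcongr
        refine h2.trans ?_
        gcongr
    _ = _ := by
        rw [ENNReal.ofReal_add (by positivity) (by norm_num), ENNReal.ofReal_ofNat]
        ring

/-- The undifferentiated factor is kept in `L²` instead of `H1`. This sharper form of the trace
bound is the one that the coercivity argument requires. -/
theorem lintegral_enorm_sq_tube_le (h : IsTubeWidth γ K a) (φ : 𝓢(Plane, ℂ)) {u : ℝ}
    (hu : u ∈ Set.Ioo (-a) a) :
    ∫⁻ s, ‖φ (tube γ (s, u))‖ₑ ^ 2 ≤ ENNReal.ofReal (1 / a + 8) *
      (‖H1.toL2 (schwartzH1 φ)‖ₑ ^ 2 + ‖H1.toL2 (schwartzH1 φ)‖ₑ * ‖schwartzH1 φ‖ₑ) := by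
  have h0 := h.lintegral_enorm_tube_le (contDiff_conjMul φ φ) hu
  simp only [enorm_conjMul, ← sq] at h0
  refine h0.trans ?_
  have h1 := lintegral_enorm_conjMul_le φ φ (tube γ '' strip a)
  have h2 := lintegral_enorm_fderiv_conjMul_le φ φ (tube γ '' strip a)
  simp only [enorm_conjMul, ← sq] at h1
  have h3 := eLpNorm_restrict_le φ (tube γ '' strip a)
  have ha := h.pos
  set n := ‖H1.toL2 (schwartzH1 φ)‖ₑ
  calc _ ≤ ENNReal.ofReal (1 / a) * n ^ 2 +
        2 * (2 * ‖schwartzH1 φ‖ₑ * n + n * (2 * ‖schwartzH1 φ‖ₑ)) := by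
        gcongr
        refine h2.trans ?_
        gcongr
    -- The missing cross terms are added so that the constant `1 / a + 8` factors out.
    _ ≤ ENNReal.ofReal (1 / a) * n ^ 2 +
        2 * (2 * ‖schwartzH1 φ‖ₑ * n + n * (2 * ‖schwartzH1 φ‖ₑ)) +
        (8 * n ^ 2 + ENNReal.ofReal (1 / a) * (n * ‖schwartzH1 φ‖ₑ)) := le_self_add
    _ = _ := by
        rw [ENNReal.ofReal_add (by positivity) (by norm_num), ENNReal.ofReal_ofNat]
        ring

theorem lintegral_enorm_sq_tube_le' (h : IsTubeWidth γ K a) (φ : 𝓢(Plane, ℂ)) {u : ℝ}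
    (hu : u ∈ Set.Ioo (-a) a) :
    ∫⁻ s, ‖φ (tube γ (s, u))‖ₑ ^ 2 ≤ ENNReal.ofReal (1 / a + 8) * ‖schwartzH1 φ‖ₑ ^ 2 := by
  have := h.lintegral_enorm_conjMul_tube_le φ φ hu
  simpa only [enorm_conjMul, ← sq] using this

/-- The source of the smallness: a thin tube is a union of parallel curves, each with a trace bound
whose constant depends on the fixed width `a` and not on `b`. Under the root stand the density
factor 2 and the interval length `2b`. -/
theorem eLpNorm_tube_le (h : IsTubeWidth γ K a) {b : ℝ} (hb : 0 < b) (hba : b ≤ a)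
    (φ : 𝓢(Plane, ℂ)) :
    eLpNorm φ 2 (volume.restrict (tube γ '' strip b)) ≤
      ENNReal.ofReal (Real.sqrt (4 * b * (1 / a + 8))) * ‖schwartzH1 φ‖ₑ := by
  have ha := h.pos
  have hm : Measurable fun x => ‖φ x‖ₑ ^ 2 := (φ.continuous.enorm.measurable).pow_const 2
  have hm' : Measurable fun p => ‖φ (tube γ p)‖ₑ ^ 2 := hm.comp h.curve.continuous_tube.measurable
  rw [← ENNReal.pow_le_pow_left_iff two_ne_zero, eLpNorm_two_sq]
  calc ∫⁻ x in tube γ '' strip b, ‖φ x‖ₑ ^ 2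
      ≤ 2 * ∫⁻ p, ‖φ (tube γ p)‖ₑ ^ 2 ∂stripMeasure b :=
        (h.mono hb hba).lintegral_tube_le hm
    _ = 2 * ∫⁻ u in Set.Ioo (-b) b, ∫⁻ s, ‖φ (tube γ (s, u))‖ₑ ^ 2 := by
        rw [lintegral_prod_symm _ hm'.aemeasurable]
    _ ≤ 2 * ∫⁻ _ in Set.Ioo (-b) b, ENNReal.ofReal (1 / a + 8) * ‖schwartzH1 φ‖ₑ ^ 2 := by
        gcongr 2 * ?_
        refine setLIntegral_mono' measurableSet_Ioo fun u hu => h.lintegral_enorm_sq_tube_le' φ ?_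
        exact Set.Ioo_subset_Ioo (neg_le_neg hba) hba hu
    _ = _ := by
        rw [setLIntegral_const, Real.volume_Ioo, mul_pow, ← ENNReal.ofReal_pow (by positivity),
          Real.sq_sqrt (by positivity)]
        generalize ‖schwartzH1 φ‖ₑ ^ 2 = N
        rw [show (2 : ℝ≥0∞) = ENNReal.ofReal 2 by simp, mul_right_comm, ← mul_assoc, ← ENNReal.ofReal_mul (by positivity),
          ← ENNReal.ofReal_mul (by positivity)]
        congr 2
        ring

/-- The rate of convergence of the forms. -/
def rate (K a b : ℝ) : ℝ := 8 * Real.sqrt (4 * b * (1 / a + 8)) + b * K * (1 / a + 8)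

theorem tendsto_rate (K a : ℝ) : Tendsto (rate K a) (𝓝[>] 0) (𝓝 0) := by
  have h : Continuous (rate K a) := by unfold rate; fun_prop
  have h0 := h.tendsto 0
  simp only [rate, mul_zero, zero_mul, Real.sqrt_zero, add_zero] at h0
  exact h0.mono_left nhdsWithin_le_nhds

theorem tube_zero (γ : ℝ → Plane) (s : ℝ) : tube γ (s, 0) = γ s := by simp [tube]

/-- Functions near the curve are close to their values on the curve. -/
theorem lintegral_tubeDensity_mul_sub_le (h : IsTubeWidth γ K a) {b : ℝ} (hb : 0 < b) (hba : b ≤ a)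
    (φ ψ : 𝓢(Plane, ℂ)) :
    ∫⁻ p, ‖(tubeDensity γ p : ℂ) * conjMul φ ψ (tube γ p) - conjMul φ ψ (γ p.1)‖ₑ ∂stripMeasure b ≤
      ENNReal.ofReal (2 * b) * (ENNReal.ofReal (rate K a b) *
        (‖schwartzH1 φ‖ₑ * ‖schwartzH1 ψ‖ₑ)) := by
  have hK := h.curvature_nonneg
  have ha := h.pos
  have hb' := h.mono hb hba
  have hct := h.curve.continuous_tube
  have hcγ := h.curve.contDiff.continuous
  have hcf := (contDiff_conjMul φ ψ).continuous
  set f := conjMul φ ψ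
  set N := ‖schwartzH1 φ‖ₑ * ‖schwartzH1 ψ‖ₑ
  have hD : ∀ u ∈ Set.Ioo (-b) b, ∫⁻ s, ‖f (tube γ (s, u)) - f (γ s)‖ₑ ≤
      ENNReal.ofReal (8 * Real.sqrt (4 * b * (1 / a + 8))) * N := by
    intro u hu
    -- The tube of width `b` is used here, so the gradient is integrated over the thin tube only and
    -- the undifferentiated factors are `O(√b)`.
    have h1 := hb'.lintegral_tube_sub_le (contDiff_conjMul φ ψ) hu (v := 0)
      ⟨by linarith, by linarith⟩
    simp only [tube_zero] at h1
    refine h1.trans ?_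
    have h2 := lintegral_enorm_fderiv_conjMul_le φ ψ (tube γ '' strip b)
    have h3 := h.eLpNorm_tube_le hb hba φ
    have h4 := h.eLpNorm_tube_le hb hba ψ
    set c := ENNReal.ofReal (Real.sqrt (4 * b * (1 / a + 8)))
    calc _ ≤ 2 * (2 * ‖schwartzH1 φ‖ₑ * (c * ‖schwartzH1 ψ‖ₑ) +
          c * ‖schwartzH1 φ‖ₑ * (2 * ‖schwartzH1 ψ‖ₑ)) := by
          gcongr
          refine h2.trans ?_
          gcongr
      _ = _ := by
          rw [ENNReal.ofReal_mul (by norm_num), ENNReal.ofReal_ofNat]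
          simp only [N, c]
          ring
  have hT : ∀ u ∈ Set.Ioo (-b) b, ∫⁻ s, ‖f (tube γ (s, u))‖ₑ ≤ ENNReal.ofReal (1 / a + 8) * N :=
    fun u hu => h.lintegral_enorm_conjMul_tube_le φ ψ (Set.Ioo_subset_Ioo (neg_le_neg hba) hba hu)
  -- The increment of `f` and the deviation of the density from 1 are separated; they give the two
  -- terms of `rate`.
  have hpt : ∀ p ∈ strip b, ‖(tubeDensity γ p : ℂ) * f (tube γ p) - f (γ p.1)‖ₑ ≤
      ‖f (tube γ p) - f (γ p.1)‖ₑ + ENNReal.ofReal (b * K) * ‖f (tube γ p)‖ₑ := by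
    intro p hp
    have e : (tubeDensity γ p : ℂ) * f (tube γ p) - f (γ p.1) =
        (f (tube γ p) - f (γ p.1)) + ((tubeDensity γ p - 1 : ℝ) : ℂ) * f (tube γ p) := by
      push_cast; ring
    rw [e]
    refine (enorm_add_le _ _).trans ?_
    rw [enorm_mul]
    gcongr
    rw [← ofReal_norm, Complex.norm_real]
    exact ENNReal.ofReal_le_ofReal (hb'.abs_tubeDensity_sub_one_le hp)
  have hm1 : Measurable fun p : ℝ × ℝ => ‖f (tube γ p) - f (γ p.1)‖ₑ :=
    Continuous.measurable (by fun_prop)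
  have hm2 : Measurable fun p : ℝ × ℝ => ‖f (tube γ p)‖ₑ := Continuous.measurable (by fun_prop)
  have hm4 : Measurable fun p : ℝ × ℝ => ‖f (tube γ p) - f (γ p.1)‖ₑ +
      ENNReal.ofReal (b * K) * ‖f (tube γ p)‖ₑ := hm1.add (hm2.const_mul _)
  clear_value N
  calc _ ≤ ∫⁻ p, (‖f (tube γ p) - f (γ p.1)‖ₑ +
        ENNReal.ofReal (b * K) * ‖f (tube γ p)‖ₑ) ∂stripMeasure b := by
        refine lintegral_mono_ae ?_
        filter_upwards [ae_stripMeasure b] with p hp using hpt p hp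
    _ = ∫⁻ u in Set.Ioo (-b) b, ((∫⁻ s, ‖f (tube γ (s, u)) - f (γ s)‖ₑ) +
        ENNReal.ofReal (b * K) * ∫⁻ s, ‖f (tube γ (s, u))‖ₑ) := by
        rw [lintegral_prod_symm _ hm4.aemeasurable]
        refine lintegral_congr fun u => ?_
        have hm3 : Measurable fun s => ‖f (tube γ (s, u)) - f (γ s)‖ₑ :=
          hm1.comp (measurable_id.prodMk measurable_const)
        rw [lintegral_add_left hm3, lintegral_const_mul' _ _ (by simp)]
    _ ≤ ∫⁻ _ in Set.Ioo (-b) b, (ENNReal.ofReal (8 * Real.sqrt (4 * b * (1 / a + 8))) * N +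
        ENNReal.ofReal (b * K) * (ENNReal.ofReal (1 / a + 8) * N)) :=
        setLIntegral_mono' measurableSet_Ioo fun u hu =>
          add_le_add (hD u hu) (by gcongr; exact hT u hu)
    _ = _ := by
        rw [setLIntegral_const, Real.volume_Ioo, ← mul_assoc, ← ENNReal.ofReal_mul (by positivity),
          ← add_mul, ← ENNReal.ofReal_add (by positivity) (by positivity), mul_comm, rate]
        congr 2
        ring

end IsTubeWidth

/-! ### The trace operator -/

namespace IsTubeWidth

variable {γ : ℝ → Plane} {K a : ℝ}

theorem eLpNorm_curveMeasure_sq_le (h : IsTubeWidth γ K a) (φ : 𝓢(Plane, ℂ)) :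
    eLpNorm φ 2 (curveMeasure γ) ^ 2 ≤ ENNReal.ofReal (1 / a + 8) *
      (‖H1.toL2 (schwartzH1 φ)‖ₑ ^ 2 + ‖H1.toL2 (schwartzH1 φ)‖ₑ * ‖schwartzH1 φ‖ₑ) := by
  have hm : Measurable fun x => ‖φ x‖ₑ ^ 2 := (φ.continuous.enorm.measurable).pow_const 2
  rw [eLpNorm_two_sq, h.curve.curveMeasure_eq, lintegral_map hm h.curve.contDiff.continuous.measurable]
  have ha := h.pos
  have := h.lintegral_enorm_sq_tube_le φ (u := 0) ⟨by linarith, by linarith⟩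
  simpa only [tube_zero] using this

theorem memLp_curveMeasure (h : IsTubeWidth γ K a) (φ : 𝓢(Plane, ℂ)) :
    MemLp φ 2 (curveMeasure γ) := by
  refine ⟨φ.continuous.aestronglyMeasurable, ?_⟩
  have h1 := (h.eLpNorm_curveMeasure_sq_le φ).trans_lt (ENNReal.mul_lt_top (by simp)
    (ENNReal.add_lt_top.2 ⟨by simp, ENNReal.mul_lt_top (by simp) (by simp)⟩))
  by_contra hcon
  rw [top_le_iff.1 (not_lt.1 hcon)] at h1
  simp at h1

/-- The restriction of Schwartz functions to the curve. -/
def restrictCurve (h : IsTubeWidth γ K a) : 𝓢(Plane, ℂ) →ₗ[ℂ] Lp ℂ 2 (curveMeasure γ) where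
  toFun φ := (h.memLp_curveMeasure φ).toLp φ
  map_add' _ _ := rfl
  map_smul' _ _ := rfl

theorem norm_restrictCurve_sq_le (h : IsTubeWidth γ K a) (φ : 𝓢(Plane, ℂ)) :
    ‖h.restrictCurve φ‖ ^ 2 ≤ (1 / a + 8) *
      (‖H1.toL2 (schwartzH1 φ)‖ ^ 2 + ‖H1.toL2 (schwartzH1 φ)‖ * ‖schwartzH1 φ‖) := by
  have ha := h.pos
  have h1 := h.eLpNorm_curveMeasure_sq_le φ
  have e : eLpNorm φ 2 (curveMeasure γ) = ‖h.restrictCurve φ‖ₑ :=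
    (Lp.enorm_toLp (h.memLp_curveMeasure φ)).symm
  rw [e] at h1
  simp only [← ofReal_norm] at h1
  rw [← ENNReal.ofReal_pow (norm_nonneg _), ← ENNReal.ofReal_pow (norm_nonneg _),
    ← ENNReal.ofReal_mul (norm_nonneg _), ← ENNReal.ofReal_add (by positivity) (by positivity),
    ← ENNReal.ofReal_mul (by positivity), ENNReal.ofReal_le_ofReal_iff (by positivity)] at h1
  exact h1

theorem norm_restrictCurve_le (h : IsTubeWidth γ K a) (φ : 𝓢(Plane, ℂ)) :
    ‖h.restrictCurve φ‖ ≤ Real.sqrt (2 * (1 / a + 8)) * ‖schwartzH1 φ‖ := by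
  have ha := h.pos
  refine le_of_sq_le_sq ?_ (by positivity)
  rw [mul_pow, Real.sq_sqrt (by positivity)]
  refine (h.norm_restrictCurve_sq_le φ).trans ?_
  have h1 : ‖H1.toL2 (schwartzH1 φ)‖ ≤ ‖schwartzH1 φ‖ := H1.norm_comp_le none _
  calc _ ≤ (1 / a + 8) * (‖schwartzH1 φ‖ ^ 2 + ‖schwartzH1 φ‖ * ‖schwartzH1 φ‖) := by gcongr
    _ = _ := by ring

/-- The trace operator `I_m` of the curve. -/
def trace (h : IsTubeWidth γ K a) : H1 →L[ℂ] Lp ℂ 2 (curveMeasure γ) :=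
  h.restrictCurve.extendOfNorm schwartzH1

theorem trace_schwartzH1 (h : IsTubeWidth γ K a) (φ : 𝓢(Plane, ℂ)) :
    h.trace (schwartzH1 φ) = h.restrictCurve φ :=
  LinearMap.extendOfNorm_eq denseRange_schwartzH1 ⟨_, h.norm_restrictCurve_le⟩ φ

theorem norm_trace_sq_le (h : IsTubeWidth γ K a) (v : H1) :
    ‖h.trace v‖ ^ 2 ≤ (1 / a + 8) * (‖H1.toL2 v‖ ^ 2 + ‖H1.toL2 v‖ * ‖v‖) := by
  refine denseRange_schwartzH1.induction_on (p := fun v =>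
    ‖h.trace v‖ ^ 2 ≤ (1 / a + 8) * (‖H1.toL2 v‖ ^ 2 + ‖H1.toL2 v‖ * ‖v‖)) v
    (isClosed_le (by fun_prop) (by fun_prop)) fun φ => ?_
  simp only [trace_schwartzH1]
  exact h.norm_restrictCurve_sq_le φ

end IsTubeWidth

theorem tendsto_H1_iff {α : Type*} {l : Filter α} {f : α → H1} {v : H1} :
    Tendsto f l (𝓝 v) ↔ ∀ j, Tendsto (fun x => H1.comp j (f x)) l (𝓝 (H1.comp j v)) := by
  constructor
  · intro h j
    exact ((H1.comp j).continuous.tendsto v).comp h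
  · intro h
    rw [tendsto_subtype_rng]
    have := ((PiLp.continuous_toLp 2 fun _ : Option (Fin 2) => L2).tendsto _).comp
      (tendsto_pi_nhds.2 h)
    exact this

namespace IsTubeWidth

variable {γ : ℝ → Plane} {K a : ℝ}

/-- Since the trace is bounded on `H1`, every approximating sequence of Schwartz functions has the
same limit on the curve, and density provides such a sequence. -/
theorem isTrace_iff (h : IsTubeWidth γ K a) (v : H1) (g : Lp ℂ 2 (curveMeasure γ)) :
    IsTrace (curveMeasure γ) ⟨H1.toL2 v, H1.toL2_mem_sobolev v⟩ g ↔ h.trace v = g := by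
  have hmem : ∀ φ : 𝓢(Plane, ℂ), MemLp φ 2 (curveMeasure γ) := h.memLp_curveMeasure
  have hconv : ∀ φ : ℕ → 𝓢(Plane, ℂ),
      Tendsto (fun n => eLpNorm (fun x => φ n x - g x) 2 (curveMeasure γ)) atTop (𝓝 0) ↔
        Tendsto (fun n => h.trace (schwartzH1 (φ n))) atTop (𝓝 g) := by
    intro φ
    rw [Lp.tendsto_Lp_iff_tendsto_eLpNorm']
    refine tendsto_congr fun n => eLpNorm_congr_ae ?_
    rw [h.trace_schwartzH1]
    filter_upwards [(hmem (φ n)).coeFn_toLp] with x hx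
    rw [Pi.sub_apply]
    congr 1
    exact hx.symm
  have hH1 : ∀ φ : ℕ → 𝓢(Plane, ℂ), Tendsto (fun n => schwartzH1 (φ n)) atTop (𝓝 v) ↔
      Tendsto (fun n => (φ n).toLp 2 volume) atTop (𝓝 (H1.toL2 v)) ∧
      ∀ i : Fin 2, Tendsto (fun n => (∂_{coordVec i} (φ n)).toLp 2 volume) atTop
        (𝓝 (partialDeriv i ⟨H1.toL2 v, H1.toL2_mem_sobolev v⟩)) := by
    intro φ
    rw [tendsto_H1_iff, Option.forall]
    simp only [comp_some_schwartzH1, partialDeriv_toL2, toL2_schwartzH1]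
  constructor
  · rintro ⟨φ, h1, h2, h3⟩
    exact tendsto_nhds_unique ((h.trace.continuous.tendsto v).comp ((hH1 φ).2 ⟨h1, h2⟩))
      ((hconv φ).1 h3)
  · rintro rfl
    obtain ⟨x, hx, hx'⟩ := mem_closure_iff_seq_limit.1 (denseRange_schwartzH1 v)
    choose φ hφ using hx
    have h4 : Tendsto (fun n => schwartzH1 (φ n)) atTop (𝓝 v) := by simpa only [hφ] using hx'
    exact ⟨φ, ((hH1 φ).1 h4).1, ((hH1 φ).1 h4).2,
      (hconv φ).2 ((h.trace.continuous.tendsto v).comp h4)⟩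

end IsTubeWidth

theorem inner_smul_adjoint_comp_right {V F : Type*} [NormedAddCommGroup V]
    [InnerProductSpace ℂ V] [CompleteSpace V] [NormedAddCommGroup F] [InnerProductSpace ℂ F]
    [CompleteSpace F] (c : ℂ) (T : V →L[ℂ] F) (v w : V) :
    inner ℂ v ((c • (T.adjoint ∘L T)) w) = c * inner ℂ (T v) (T w) := by
  rw [smul_apply, inner_smul_right, ContinuousLinearMap.comp_apply,
    ContinuousLinearMap.adjoint_inner_right]

theorem isSelfAdjoint_of_inner {V : Type*} [NormedAddCommGroup V] [InnerProductSpace ℂ V]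
    [CompleteSpace V] {T : V →L[ℂ] V}
    (h : ∀ v w, starRingEnd ℂ (inner ℂ v (T w)) = inner ℂ w (T v)) : IsSelfAdjoint T := by
  rw [ContinuousLinearMap.isSelfAdjoint_iff_isSymmetric]
  intro v w
  change inner ℂ (T v) w = inner ℂ v (T w)
  rw [← inner_conj_symm, h]

namespace IsTubeWidth

variable {γ : ℝ → Plane} {K a : ℝ}

/-- The operator on `H1` representing the form `α ∫ conj(I_m φ) I_m ψ dm`. -/
def deltaForm (h : IsTubeWidth γ K a) (α : ℝ) : H1 →L[ℂ] H1 :=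
  (α : ℂ) • (h.trace.adjoint ∘L h.trace)

theorem inner_deltaForm (h : IsTubeWidth γ K a) (α : ℝ) (v w : H1) :
    inner ℂ v (h.deltaForm α w) = α * inner ℂ (h.trace v) (h.trace w) :=
  inner_smul_adjoint_comp_right (α : ℂ) h.trace v w

theorem isSelfAdjoint_deltaForm (h : IsTubeWidth γ K a) (α : ℝ) :
    IsSelfAdjoint (h.deltaForm α) :=
  isSelfAdjoint_of_inner fun v w => by
    rw [h.inner_deltaForm, h.inner_deltaForm, map_mul, Complex.conj_ofReal, inner_conj_symm]

theorem norm_inner_deltaForm_le (h : IsTubeWidth γ K a) (α : ℝ) (v : H1) :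
    ‖inner ℂ (h.deltaForm α v) v‖ ≤
      |α| * (1 / a + 8) * (‖H1.toL2 v‖ ^ 2 + ‖H1.toL2 v‖ * ‖v‖) := by
  have e : ‖inner ℂ (h.deltaForm α v) v‖ = ‖inner ℂ v (h.deltaForm α v)‖ := norm_inner_symm _ _
  rw [e, h.inner_deltaForm, norm_mul, Complex.norm_real, Real.norm_eq_abs,
    mul_assoc]
  gcongr
  refine (norm_inner_le_norm _ _).trans ?_
  rw [← sq]
  exact h.norm_trace_sq_le v

end IsTubeWidth

/-- At `z = 0` the term `J* J` cancels the `L²` part of the `H1` inner product, which leaves the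
weak formulation with the gradient term alone. -/
theorem shiftedForm_zero_eq_iff (B : H1 →L[ℂ] H1) (v : H1) (η : L2) :
    shiftedForm H1.toL2 B 0 v = H1.toL2.adjoint η ↔ ∀ w : H1,
      ∑ i, inner ℂ (H1.comp (some i) w) (H1.comp (some i) v) - inner ℂ w (B v) =
        inner ℂ (H1.toL2 w) η := by
  have e : ∀ w : H1, inner ℂ w (shiftedForm H1.toL2 B 0 v) =
      ∑ i, inner ℂ (H1.comp (some i) w) (H1.comp (some i) v) - inner ℂ w (B v) := by
    intro w
    simp only [shiftedForm, add_zero, one_smul, sub_apply, ContinuousLinearMap.comp_apply,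
      inner_sub_right, ContinuousLinearMap.adjoint_inner_right, one_apply_eq_self]
    rw [H1.inner_eq]
    ring
  constructor
  · intro hv w
    rw [← e, hv, ContinuousLinearMap.adjoint_inner_right]
  · intro hv
    refine ext_inner_left ℂ fun w => ?_
    rw [e, hv, ContinuousLinearMap.adjoint_inner_right]

namespace IsTubeWidth

variable {γ : ℝ → Plane} {K a : ℝ}

theorem mem_singularGraph_iff (h : IsTubeWidth γ K a) (α : ℝ) (ψ η : L2) :
    (ψ, η) ∈ singularGraph α (curveMeasure γ) ↔
      ∃ v : H1, H1.toL2 v = ψ ∧ shiftedForm H1.toL2 (h.deltaForm α) 0 v = H1.toL2.adjoint η := by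
  have hform : ∀ v w : H1, singularForm α (curveMeasure γ)
      ⟨H1.toL2 w, H1.toL2_mem_sobolev w⟩ ⟨H1.toL2 v, H1.toL2_mem_sobolev v⟩ (h.trace w)
      (h.trace v) = ∑ i, inner ℂ (H1.comp (some i) w) (H1.comp (some i) v) -
        inner ℂ w (h.deltaForm α v) := by
    intro v w
    simp only [singularForm, partialDeriv_toL2, h.inner_deltaForm]
  have hlift : ∀ φ : sobolev 1, ∃ w : H1,
      φ = ⟨H1.toL2 w, H1.toL2_mem_sobolev w⟩ := by
    intro φ
    obtain ⟨w, hw, -⟩ := exists_H1_of_sobolev φ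
    exact ⟨w, Subtype.ext hw.symm⟩
  constructor
  · rintro ⟨φ, g, hφ, ht, hf⟩
    obtain ⟨v, rfl⟩ := hlift φ
    rw [h.isTrace_iff] at ht
    subst ht
    refine ⟨v, hφ, (shiftedForm_zero_eq_iff _ _ _).2 fun w => ?_⟩
    rw [← hform]
    exact hf _ _ ((h.isTrace_iff w _).2 rfl)
  · rintro ⟨v, hv, hs⟩
    rw [shiftedForm_zero_eq_iff] at hs
    refine ⟨_, h.trace v, hv, (h.isTrace_iff v _).2 rfl, fun φ g hg => ?_⟩
    obtain ⟨w, rfl⟩ := hlift φ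
    rw [h.isTrace_iff] at hg
    subst hg
    rw [hform, hs w]

theorem isFormOperator_deltaOperator (h : IsTubeWidth γ K a) (α : ℝ) :
    IsFormOperator H1.toL2 (h.deltaForm α) (deltaOperator α γ) := by
  intro ψ η
  rw [deltaOperator, singularOperator, Submodule.toLinearPMap_graph_eq, h.mem_singularGraph_iff]
  -- The graph must be single-valued: a pair `(0, y)` forces `J* y = 0`, and then `y = 0` because
  -- `J` has dense range.
  rintro ⟨x, y⟩ hx rfl
  obtain ⟨v, hv, hv'⟩ := (h.mem_singularGraph_iff α 0 y).1 hx
  have hv0 : v = 0 := H1.ext_toL2 (by rw [hv, map_zero])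
  rw [hv0, map_zero] at hv'
  refine denseRange_toL2.eq_zero_of_inner_right ℂ fun w => ?_
  rw [← ContinuousLinearMap.adjoint_inner_right, ← hv', inner_zero_right]

end IsTubeWidth

/-! ### Bounded potentials -/

/-- `V` is measurable and essentially bounded by `C`. -/
structure IsBoundedPotential (V : Plane → ℝ) (C : ℝ) : Prop where
  aestronglyMeasurable : AEStronglyMeasurable V volume
  norm_le : ∀ᵐ x, ‖V x‖ ≤ C

namespace IsBoundedPotential

variable {V : Plane → ℝ} {C : ℝ}

theorem norm_mul_le (hV : IsBoundedPotential V C) (f : L2) :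
    ∀ᵐ x, ‖(V x : ℂ) * f x‖ ≤ C * ‖f x‖ := by
  filter_upwards [hV.norm_le] with x hx
  rw [norm_mul, Complex.norm_real]
  gcongr

theorem memLp_mul (hV : IsBoundedPotential V C) (f : L2) :
    MemLp (fun x => (V x : ℂ) * f x) 2 volume :=
  (Lp.memLp f).of_le_mul
    ((Complex.continuous_ofReal.comp_aestronglyMeasurable hV.aestronglyMeasurable).mul
      (Lp.aestronglyMeasurable f)) (hV.norm_mul_le f)

/-- Multiplication by a bounded potential. -/
def mulCLM (hV : IsBoundedPotential V C) : L2 →L[ℂ] L2 :=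
  LinearMap.mkContinuous
    { toFun := fun f => (hV.memLp_mul f).toLp
      map_add' := fun f g => by
        rw [← MemLp.toLp_add, MemLp.toLp_eq_toLp_iff]
        filter_upwards [Lp.coeFn_add f g] with x hx
        simp only [hx, Pi.add_apply, mul_add]
      map_smul' := fun c f => by
        rw [RingHom.id_apply, ← MemLp.toLp_const_smul, MemLp.toLp_eq_toLp_iff]
        filter_upwards [Lp.coeFn_smul c f] with x hx
        simp [hx, mul_left_comm] } C
    fun f => by
      refine Lp.norm_le_mul_norm_of_ae_le_mul ?_
      filter_upwards [(hV.memLp_mul f).coeFn_toLp, hV.norm_mul_le f] with x hx hx'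
      exact (congrArg norm hx).trans_le hx'

theorem mulCLM_apply (hV : IsBoundedPotential V C) (f : L2) :
    hV.mulCLM f = (hV.memLp_mul f).toLp (fun x => (V x : ℂ) * f x) := rfl

theorem inner_mulCLM (hV : IsBoundedPotential V C) (f g : L2) :
    inner ℂ f (hV.mulCLM g) = ∫ x, (V x : ℂ) * (starRingEnd ℂ (f x) * g x) := by
  rw [L2.inner_def]
  refine integral_congr_ae ?_
  filter_upwards [(hV.memLp_mul g).coeFn_toLp] with x hx
  rw [mulCLM_apply, hx, RCLike.inner_apply]
  ring

theorem conj_inner_mulCLM (hV : IsBoundedPotential V C) (f g : L2) :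
    starRingEnd ℂ (inner ℂ f (hV.mulCLM g)) = inner ℂ g (hV.mulCLM f) := by
  rw [hV.inner_mulCLM, hV.inner_mulCLM, ← integral_conj]
  refine integral_congr_ae (Eventually.of_forall fun x => ?_)
  simp only [map_mul, Complex.conj_ofReal, Complex.conj_conj]
  ring

/-- The operator on `H1` representing the form `-∫ V conj(φ) ψ dx`. -/
def form (hV : IsBoundedPotential V C) : H1 →L[ℂ] H1 :=
  -(H1.toL2.adjoint ∘L hV.mulCLM ∘L H1.toL2)

theorem inner_form (hV : IsBoundedPotential V C) (v w : H1) :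
    inner ℂ v (hV.form w) = -inner ℂ (H1.toL2 v) (hV.mulCLM (H1.toL2 w)) := by
  rw [form, neg_apply, inner_neg_right, ContinuousLinearMap.comp_apply,
    ContinuousLinearMap.adjoint_inner_right, ContinuousLinearMap.comp_apply]

theorem isSelfAdjoint_form (hV : IsBoundedPotential V C) : IsSelfAdjoint hV.form :=
  isSelfAdjoint_of_inner fun v w => by
    rw [inner_form, inner_form, map_neg, conj_inner_mulCLM]

/-- The form equation says that `Δ ψ = V ψ - η` weakly. For bounded `V` the right side is in `L²`,
so elliptic regularity puts `ψ` in `sobolev 2`, the domain of the operator sum. -/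
theorem isFormOperator_schrodinger (hV : IsBoundedPotential V C) :
    IsFormOperator H1.toL2 hV.form (schrodinger V) := by
  have key : ∀ (v : H1) (η : L2), shiftedForm H1.toL2 hV.form 0 v = H1.toL2.adjoint η ↔
      Δ (H1.toL2 v : 𝓢'(Plane, ℂ)) =
        ((-(η - hV.mulCLM (H1.toL2 v)) : L2) : 𝓢'(Plane, ℂ)) := by
    intro v η
    rw [shiftedForm_zero_eq_iff, neg_laplacian_eq_iff]
    refine forall_congr' fun w => ?_
    rw [inner_form, sub_neg_eq_add, inner_sub_right, eq_sub_iff_add_eq]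
  have hval : ∀ ψ : (schrodinger V).domain,
      schrodinger V ψ = -laplacianL2 ⟨ψ, ψ.2.1⟩ + hV.mulCLM ψ := fun ψ => rfl
  intro ψ η
  rw [LinearPMap.mem_graph_iff]
  constructor
  · rintro ⟨χ, rfl, hχ⟩
    obtain ⟨v, hv, -⟩ := exists_H1_of_sobolev ⟨χ, sobolev_two_le_one χ.2.1⟩
    refine ⟨v, hv, (key v η).2 ?_⟩
    have hv' : H1.toL2 v = χ := hv
    have e : -(η - hV.mulCLM χ) = laplacianL2 ⟨χ, χ.2.1⟩ := by
      have hη : -laplacianL2 ⟨χ, χ.2.1⟩ + hV.mulCLM χ = η := hχ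
      rw [← hη]
      abel
    rw [hv', e]
    exact laplacianL2_spec ⟨χ, χ.2.1⟩
  · rintro ⟨v, rfl, hv⟩
    have hΔ := (key v η).1 hv
    have hmem := mem_sobolev_two_of_laplacian hΔ
    refine ⟨⟨H1.toL2 v, hmem, hV.memLp_mul _⟩, rfl, ?_⟩
    have e : laplacianL2 ⟨H1.toL2 v, hmem⟩ = -(η - hV.mulCLM (H1.toL2 v)) :=
      toTemperedDistribution_injective ((laplacianL2_spec ⟨H1.toL2 v, hmem⟩).symm.trans hΔ)
    rw [hval]
    change -laplacianL2 ⟨H1.toL2 v, hmem⟩ + hV.mulCLM (H1.toL2 v) = η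
    rw [e]
    abel

end IsBoundedPotential

/-! ### The scaled potential in tubular coordinates -/

namespace IsTubeWidth

variable {γ : ℝ → Plane} {K a : ℝ}

/-- The volume measure of the tube in tubular coordinates. -/
abbrev tubeMeasure (γ : ℝ → Plane) (b : ℝ) : Measure (ℝ × ℝ) :=
  (stripMeasure b).withDensity fun p => ENNReal.ofReal (tubeDensity γ p)

theorem tubeMeasure_absolutelyContinuous (γ : ℝ → Plane) (b : ℝ) :
    tubeMeasure γ b ≪ stripMeasure b :=
  withDensity_absolutelyContinuous _ _

/-- The profile `W` is measurable only up to null sets. Viewing the tube map as a measurable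
embedding of the strip lets almost everywhere statements, a.e. measurability and Bochner integrals
pass between the coordinates without measurability assumptions on the plane. -/
theorem measurableEmbedding_tube (h : IsTubeWidth γ K a) :
    MeasurableEmbedding (fun p : strip a => tube γ p) :=
  h.curve.continuous_tube.continuousOn.measurableEmbedding (measurableSet_strip a) h.injOn

theorem map_val_tubeMeasure (γ : ℝ → Plane) (b : ℝ) :
    Measure.map Subtype.val (Measure.comap (Subtype.val : strip b → ℝ × ℝ) (tubeMeasure γ b)) =
      tubeMeasure γ b := by
  rw [map_comap_subtype_coe (measurableSet_strip b)]
  exact Measure.restrict_eq_self_of_ae_mem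
    ((tubeMeasure_absolutelyContinuous γ b).ae_le (ae_stripMeasure b))

theorem map_tube_subtype (h : IsTubeWidth γ K a) :
    Measure.map (fun p : strip a => tube γ p)
      (Measure.comap (Subtype.val : strip a → ℝ × ℝ) (tubeMeasure γ a)) =
      volume.restrict (tube γ '' strip a) := by
  have e : Measure.map (tube γ) (tubeMeasure γ a) = volume.restrict (tube γ '' strip a) := h.map_tube
  rw [← e]
  conv_rhs => rw [← map_val_tubeMeasure γ a]
  exact (Measure.map_map h.curve.continuous_tube.measurable measurable_subtype_coe).symm

theorem aestronglyMeasurable_of_tube (h : IsTubeWidth γ K a) {F : Plane → ℝ}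
    (hF : AEStronglyMeasurable (fun p => F (tube γ p)) (stripMeasure a)) :
    AEStronglyMeasurable F (volume.restrict (tube γ '' strip a)) := by
  rw [← h.map_tube_subtype, h.measurableEmbedding_tube.aestronglyMeasurable_map_iff]
  have h1 := hF.mono_ac (tubeMeasure_absolutelyContinuous γ a)
  rw [← map_val_tubeMeasure γ a, (MeasurableEmbedding.subtype_coe
    (measurableSet_strip a)).aestronglyMeasurable_map_iff] at h1
  exact h1

theorem ae_of_tube (h : IsTubeWidth γ K a) {P : Plane → Prop}
    (hP : ∀ᵐ p ∂stripMeasure a, P (tube γ p)) :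
    ∀ᵐ x ∂volume.restrict (tube γ '' strip a), P x := by
  rw [← h.map_tube_subtype, h.measurableEmbedding_tube.ae_map_iff]
  have h1 := (tubeMeasure_absolutelyContinuous γ a).ae_le hP
  change ∀ᵐ p ∂tubeMeasure γ a, P (tube γ p) at h1
  rw [← map_val_tubeMeasure γ a, (MeasurableEmbedding.subtype_coe
    (measurableSet_strip a)).ae_map_iff] at h1
  exact h1

theorem integral_tube (h : IsTubeWidth γ K a) (F : Plane → ℂ) :
    ∫ x in tube γ '' strip a, F x =
      ∫ p, (tubeDensity γ p : ℂ) * F (tube γ p) ∂stripMeasure a := by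
  have hJ : Measurable fun p => ENNReal.ofReal (tubeDensity γ p) :=
    ENNReal.measurable_ofReal.comp h.measurable_tubeDensity
  rw [← h.map_tube_subtype, h.measurableEmbedding_tube.integral_map]
  have h1 := (MeasurableEmbedding.subtype_coe (measurableSet_strip a)).integral_map
    (μ := Measure.comap (Subtype.val : strip a → ℝ × ℝ) (tubeMeasure γ a))
    fun p => F (tube γ p)
  rw [← h1, map_val_tubeMeasure, integral_withDensity_eq_integral_toReal_smul hJ (by simp)]
  refine integral_congr_ae ?_
  filter_upwards [ae_stripMeasure a] with p hp
  rw [ENNReal.toReal_ofReal (by linarith [h.half_le_tubeDensity hp]), Complex.real_smul]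

variable {W : ℝ → ℝ} {C : ℝ}

/-- Injectivity of the tube map forces the chosen coordinates to be `p`. -/
theorem scaledPotential_tube (h : IsTubeWidth γ K a) (W : ℝ → ℝ) {p : ℝ × ℝ} (hp : p ∈ strip a) :
    scaledPotential W γ a (tube γ p) = -(1 / a * W (p.2 / a)) := by
  have hex : ∃ q : ℝ × ℝ, |q.2| < a ∧ tube γ p = γ q.1 + q.2 • unitNormal γ q.1 :=
    ⟨p, abs_lt.2 hp.2, rfl⟩
  have hq : hex.choose = p :=
    (h.injOn hp ⟨trivial, abs_lt.1 hex.choose_spec.1⟩ hex.choose_spec.2).symm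
  rw [scaledPotential, dif_pos hex, hq, neg_mul]

theorem scaledPotential_eq_zero (W : ℝ → ℝ) {x : Plane} (hx : x ∉ tube γ '' strip a) :
    scaledPotential W γ a x = 0 := by
  refine dif_neg ?_
  rintro ⟨p, hp, rfl⟩
  exact hx ⟨p, ⟨trivial, abs_lt.1 hp⟩, rfl⟩

end IsTubeWidth

/-- Properties of `W` hold almost everywhere on `(-1, 1)`; scaling carries them to `(-ε, ε)` because
preimages of null sets are null. -/
theorem quasiMeasurePreserving_div {ε : ℝ} (hε : 0 < ε) :
    Measure.QuasiMeasurePreserving (fun u : ℝ => u / ε) (volume.restrict (Set.Ioo (-ε) ε))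
      (volume.restrict (Set.Ioo (-1 : ℝ) 1)) := by
  have h1 : Measure.QuasiMeasurePreserving (fun u : ℝ => u / ε) volume volume := by
    refine ⟨by fun_prop, ?_⟩
    simp only [div_eq_mul_inv]
    rw [Real.map_volume_mul_right (inv_ne_zero hε.ne')]
    exact Measure.smul_absolutelyContinuous
  refine h1.restrict fun u hu => ?_
  rw [Set.mem_Ioo, lt_div_iff₀ hε, div_lt_iff₀ hε]
  simpa using hu

/-- `W` is measurable and essentially bounded by `C` on `(-1, 1)`. -/
structure IsBoundedProfile (W : ℝ → ℝ) (C : ℝ) : Prop where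
  aestronglyMeasurable : AEStronglyMeasurable W (volume.restrict (Set.Ioo (-1 : ℝ) 1))
  norm_le : ∀ᵐ t ∂volume.restrict (Set.Ioo (-1 : ℝ) 1), ‖W t‖ ≤ C

theorem exists_isBoundedProfile {W : ℝ → ℝ}
    (hW : MemLp W ⊤ (volume.restrict (Set.Ioo (-1 : ℝ) 1))) : ∃ C, IsBoundedProfile W C := by
  refine ⟨(eLpNormEssSup W (volume.restrict (Set.Ioo (-1 : ℝ) 1))).toReal, hW.1, ?_⟩
  have hlt := hW.2
  rw [eLpNorm_exponent_top] at hlt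
  filter_upwards [enorm_ae_le_eLpNormEssSup W (volume.restrict (Set.Ioo (-1 : ℝ) 1))] with t ht
  have := ENNReal.toReal_mono hlt.ne ht
  rwa [toReal_enorm] at this

namespace IsBoundedProfile

variable {W : ℝ → ℝ} {C ε : ℝ}

theorem aestronglyMeasurable_strip (hW : IsBoundedProfile W C) (hε : 0 < ε) :
    AEStronglyMeasurable (fun p : ℝ × ℝ => 1 / ε * W (p.2 / ε)) (stripMeasure ε) :=
  ((hW.aestronglyMeasurable.comp_quasiMeasurePreserving
    (quasiMeasurePreserving_div hε)).comp_snd).const_mul _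

theorem norm_strip_le (hW : IsBoundedProfile W C) (hε : 0 < ε) :
    ∀ᵐ p : ℝ × ℝ ∂stripMeasure ε, ‖1 / ε * W (p.2 / ε)‖ ≤ C / ε := by
  have h1 := ((quasiMeasurePreserving_div hε).comp
    (Measure.quasiMeasurePreserving_snd (μ := (volume : Measure ℝ)))).ae hW.norm_le
  filter_upwards [h1] with p hp
  rw [norm_mul, Real.norm_of_nonneg (by positivity : 0 ≤ 1 / ε), one_div, inv_mul_eq_div]
  gcongr
  exact hp

theorem nonneg (hW : IsBoundedProfile W C) : 0 ≤ C := by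
  have : (ae (volume.restrict (Set.Ioo (-1 : ℝ) 1))).NeBot := by
    rw [ae_neBot, Ne, Measure.restrict_eq_zero, Real.volume_Ioo]
    norm_num
  obtain ⟨t, ht⟩ := hW.norm_le.exists
  exact (norm_nonneg _).trans ht

end IsBoundedProfile

namespace IsTubeWidth

variable {γ : ℝ → Plane} {K a : ℝ} {W : ℝ → ℝ} {C : ℝ}

theorem isBoundedPotential (h : IsTubeWidth γ K a) (hW : IsBoundedProfile W C) :
    IsBoundedPotential (scaledPotential W γ a) (C / a) := by
  have hV : ∀ᵐ p ∂stripMeasure a,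
      scaledPotential W γ a (tube γ p) = -(1 / a * W (p.2 / a)) := by
    filter_upwards [ae_stripMeasure a] with p hp using h.scaledPotential_tube W hp
  have hC := hW.nonneg
  have ha := h.pos
  constructor
  · have e : scaledPotential W γ a = (tube γ '' strip a).indicator (scaledPotential W γ a) := by
      refine (Set.indicator_eq_self.2 fun x hx => ?_).symm
      by_contra hx'
      exact hx (scaledPotential_eq_zero W hx')
    rw [e, aestronglyMeasurable_indicator_iff h.measurableSet_image]
    exact h.aestronglyMeasurable_of_tube
      ((hW.aestronglyMeasurable_strip h.pos).neg.congr (hV.mono fun p hp => hp.symm))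
  · have h1 : ∀ᵐ x ∂volume.restrict (tube γ '' strip a),
        ‖scaledPotential W γ a x‖ ≤ C / a := by
      refine h.ae_of_tube ?_
      filter_upwards [hV, hW.norm_strip_le h.pos] with p hp hp'
      rwa [hp, norm_neg]
    rw [ae_restrict_iff' h.measurableSet_image] at h1
    filter_upwards [h1] with x hx
    by_cases hx' : x ∈ tube γ '' strip a
    · exact hx hx'
    · rw [scaledPotential_eq_zero W hx', norm_zero]
      positivity

end IsTubeWidth

/-! ### Convergence of the forms -/

namespace IsTubeWidth

variable {γ : ℝ → Plane} {K a : ℝ} {W : ℝ → ℝ} {C : ℝ}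

theorem inner_trace_schwartzH1 (h : IsTubeWidth γ K a) (φ ψ : 𝓢(Plane, ℂ)) :
    inner ℂ (h.trace (schwartzH1 φ)) (h.trace (schwartzH1 ψ)) = ∫ s, conjMul φ ψ (γ s) := by
  have e : ∫ s, conjMul φ ψ (γ s) = ∫ x, conjMul φ ψ x ∂curveMeasure γ := by
    rw [h.curve.curveMeasure_eq, h.curve.measurableEmbedding.integral_map]
  rw [e, h.trace_schwartzH1, h.trace_schwartzH1, L2.inner_def]
  refine integral_congr_ae ?_
  filter_upwards [(h.memLp_curveMeasure φ).coeFn_toLp, (h.memLp_curveMeasure ψ).coeFn_toLp]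
    with x hx hx'
  have hx1 : h.restrictCurve φ x = φ x := hx
  have hx2 : h.restrictCurve ψ x = ψ x := hx'
  rw [hx1, hx2, RCLike.inner_apply, conjMul, mul_comm]

theorem integrable_conjMul_curve (h : IsTubeWidth γ K a) (φ ψ : 𝓢(Plane, ℂ)) :
    Integrable fun s => conjMul φ ψ (γ s) := by
  have ha := h.pos
  have hc := (contDiff_conjMul φ ψ).continuous
  have hγ := h.curve.contDiff.continuous
  refine ⟨(hc.comp hγ).aestronglyMeasurable, ?_⟩
  have h1 := h.lintegral_enorm_conjMul_tube_le φ ψ (u := 0) ⟨by linarith, by linarith⟩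
  simp only [tube_zero] at h1
  exact h1.trans_lt (ENNReal.mul_lt_top (by simp) (ENNReal.mul_lt_top (by simp) (by simp)))

theorem integrable_tubeDensity_mul_sub (h : IsTubeWidth γ K a) {ε : ℝ} (hε : 0 < ε) (hεa : ε ≤ a)
    (φ ψ : 𝓢(Plane, ℂ)) :
    Integrable (fun p => (tubeDensity γ p : ℂ) * conjMul φ ψ (tube γ p) - conjMul φ ψ (γ p.1))
      (stripMeasure ε) := by
  have hc := (contDiff_conjMul φ ψ).continuous
  have hγ := h.curve.contDiff.continuous
  have hJ := Complex.measurable_ofReal.comp h.measurable_tubeDensity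
  refine ⟨(Measurable.sub (hJ.mul (hc.comp h.curve.continuous_tube).measurable)
    (hc.comp (hγ.comp continuous_fst)).measurable).aestronglyMeasurable, ?_⟩
  exact (h.lintegral_tubeDensity_mul_sub_le hε hεa φ ψ).trans_lt
    (ENNReal.mul_lt_top ENNReal.ofReal_lt_top (ENNReal.mul_lt_top (by simp)
      (ENNReal.mul_lt_top (by simp) (by simp))))

theorem inner_form_schwartzH1 (h : IsTubeWidth γ K a) (hW : IsBoundedProfile W C)
    (φ ψ : 𝓢(Plane, ℂ)) :
    inner ℂ (schwartzH1 φ) ((h.isBoundedPotential hW).form (schwartzH1 ψ)) =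
      ∫ p, ((1 / a * W (p.2 / a) : ℝ) : ℂ) * ((tubeDensity γ p : ℂ) * conjMul φ ψ (tube γ p))
        ∂stripMeasure a := by
  have e : ∫ x, (scaledPotential W γ a x : ℂ) *
      (starRingEnd ℂ (H1.toL2 (schwartzH1 φ) x) * H1.toL2 (schwartzH1 ψ) x) =
      ∫ x, (scaledPotential W γ a x : ℂ) * conjMul φ ψ x := by
    rw [toL2_schwartzH1, toL2_schwartzH1]
    refine integral_congr_ae ?_
    filter_upwards [φ.coeFn_toLp 2 volume, ψ.coeFn_toLp 2 volume] with x hx hx'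
    rw [hx, hx', conjMul]
  rw [IsBoundedPotential.inner_form, IsBoundedPotential.inner_mulCLM, e,
    ← setIntegral_eq_integral_of_forall_compl_eq_zero (s := tube γ '' strip a)
      (fun x hx => by rw [scaledPotential_eq_zero W hx]; simp), h.integral_tube, ← integral_neg]
  refine integral_congr_ae ?_
  filter_upwards [ae_stripMeasure a] with p hp
  rw [h.scaledPotential_tube W hp]
  push_cast
  ring

theorem integral_scaled_profile (W : ℝ → ℝ) {ε : ℝ} (hε : 0 < ε) :
    ∫ u in Set.Ioo (-ε) ε, ((1 / ε * W (u / ε) : ℝ) : ℂ) = ((∫ t in (-1 : ℝ)..1, W t : ℝ) : ℂ) := by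
  rw [integral_complex_ofReal, ← integral_Ioc_eq_integral_Ioo,
    ← intervalIntegral.integral_of_le (by linarith), intervalIntegral.integral_const_mul,
    intervalIntegral.integral_comp_div _ hε.ne', neg_div, div_self hε.ne', smul_eq_mul, ← mul_assoc,
    one_div_mul_cancel hε.ne', one_mul]

theorem enorm_inner_form_sub_schwartzH1_le (h : IsTubeWidth γ K a) (hW : IsBoundedProfile W C)
    {ε : ℝ} (hε : 0 < ε) (hεa : ε ≤ a) (φ ψ : 𝓢(Plane, ℂ)) :
    ‖inner ℂ (schwartzH1 φ) ((((h.mono hε hεa).isBoundedPotential hW).form -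
      h.deltaForm (∫ t in (-1 : ℝ)..1, W t)) (schwartzH1 ψ))‖ₑ ≤
      ENNReal.ofReal (2 * C * rate K a ε) * (‖schwartzH1 φ‖ₑ * ‖schwartzH1 ψ‖ₑ) := by
  have hC := hW.nonneg
  set ω : ℝ × ℝ → ℂ := fun p => ((1 / ε * W (p.2 / ε) : ℝ) : ℂ)
  have hω : AEStronglyMeasurable ω (stripMeasure ε) :=
    Complex.continuous_ofReal.comp_aestronglyMeasurable (hW.aestronglyMeasurable_strip hε)
  have hωC : ∀ᵐ p ∂stripMeasure ε, ‖ω p‖ ≤ C / ε := by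
    filter_upwards [hW.norm_strip_le hε] with p hp
    rwa [Complex.norm_real]
  have hi0 : Integrable (fun p : ℝ × ℝ => conjMul φ ψ (γ p.1)) (stripMeasure ε) :=
    (h.integrable_conjMul_curve φ ψ).comp_fst _
  have hi1 := h.integrable_tubeDensity_mul_sub hε hεa φ ψ
  have hj0 := hi0.bdd_mul hω hωC
  have hj1 := hi1.bdd_mul hω hωC
  -- The scaled profile has total mass `∫ W` for every `ε`, so the delta form becomes an integral
  -- over the same strip with the same weight.
  have e0 : ((∫ t in (-1 : ℝ)..1, W t : ℝ) : ℂ) * ∫ s, conjMul φ ψ (γ s) =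
      ∫ p, ω p * conjMul φ ψ (γ p.1) ∂stripMeasure ε := by
    rw [← integral_scaled_profile W hε, mul_comm, ← integral_prod_mul]
    exact integral_congr_ae (Eventually.of_forall fun p => mul_comm _ _)
  have e1 : inner ℂ (schwartzH1 φ) ((((h.mono hε hεa).isBoundedPotential hW).form -
      h.deltaForm (∫ t in (-1 : ℝ)..1, W t)) (schwartzH1 ψ)) =
      ∫ p, ω p * ((tubeDensity γ p : ℂ) * conjMul φ ψ (tube γ p) - conjMul φ ψ (γ p.1))
        ∂stripMeasure ε := by
    rw [sub_apply, inner_sub_right, (h.mono hε hεa).inner_form_schwartzH1 hW, h.inner_deltaForm,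
      h.inner_trace_schwartzH1, e0, sub_eq_iff_eq_add, ← integral_add hj1 hj0]
    refine integral_congr_ae (Eventually.of_forall fun p => ?_)
    simp only [ω]
    ring
  rw [e1]
  refine (enorm_integral_le_lintegral_enorm _).trans ?_
  calc _ ≤ ∫⁻ p, ENNReal.ofReal (C / ε) *
        ‖(tubeDensity γ p : ℂ) * conjMul φ ψ (tube γ p) - conjMul φ ψ (γ p.1)‖ₑ
        ∂stripMeasure ε := by
        refine lintegral_mono_ae ?_
        filter_upwards [hωC] with p hp
        rw [enorm_mul]
        gcongr
        rw [← ofReal_norm]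
        exact ENNReal.ofReal_le_ofReal hp
    _ = ENNReal.ofReal (C / ε) * ∫⁻ p,
        ‖(tubeDensity γ p : ℂ) * conjMul φ ψ (tube γ p) - conjMul φ ψ (γ p.1)‖ₑ
        ∂stripMeasure ε := lintegral_const_mul' _ _ (by simp)
    -- The singular weight `C / ε` is compensated exactly by the width `2ε` of the strip.
    _ ≤ ENNReal.ofReal (C / ε) * (ENNReal.ofReal (2 * ε) * (ENNReal.ofReal (rate K a ε) *
        (‖schwartzH1 φ‖ₑ * ‖schwartzH1 ψ‖ₑ))) := by
        gcongr
        exact h.lintegral_tubeDensity_mul_sub_le hε hεa φ ψ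
    _ = _ := by
        rw [← mul_assoc, ← mul_assoc, ← ENNReal.ofReal_mul (by positivity),
          ← ENNReal.ofReal_mul (by positivity)]
        congr 2
        field_simp

theorem rate_nonneg (h : IsTubeWidth γ K a) {b : ℝ} (hb : 0 ≤ b) : 0 ≤ rate K a b := by
  have hK := h.curvature_nonneg
  have ha := h.pos
  unfold rate
  positivity

theorem norm_form_sub_le (h : IsTubeWidth γ K a) (hW : IsBoundedProfile W C)
    {ε : ℝ} (hε : 0 < ε) (hεa : ε ≤ a) :
    ‖((h.mono hε hεa).isBoundedPotential hW).form - h.deltaForm (∫ t in (-1 : ℝ)..1, W t)‖ ≤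
      2 * C * rate K a ε := by
  have hC := hW.nonneg
  have hr := h.rate_nonneg hε.le
  have hS := h.enorm_inner_form_sub_schwartzH1_le hW hε hεa
  set T := ((h.mono hε hεa).isBoundedPotential hW).form - h.deltaForm (∫ t in (-1 : ℝ)..1, W t)
  have hT : ∀ v w : H1, ‖inner ℂ v (T w)‖ ≤ 2 * C * rate K a ε * (‖v‖ * ‖w‖) := by
    intro v w
    refine denseRange_schwartzH1.induction_on₂
      (p := fun v w => ‖inner ℂ v (T w)‖ ≤ 2 * C * rate K a ε * (‖v‖ * ‖w‖))
      (isClosed_le ?_ (by fun_prop)) (fun φ ψ => ?_) v w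
    · have : Continuous fun q : H1 × H1 => inner ℂ q.1 (T q.2) :=
        continuous_fst.inner (T.continuous.comp continuous_snd)
      exact this.norm
    · have h1 := hS φ ψ
      simp only [← ofReal_norm] at h1
      rwa [← ENNReal.ofReal_mul (norm_nonneg _), ← ENNReal.ofReal_mul (by positivity),
        ENNReal.ofReal_le_ofReal_iff (by positivity)] at h1
  -- Testing the sesquilinear bound with `v = T w` turns it into a bound for the operator norm.
  refine T.opNorm_le_bound (by positivity) fun w => ?_
  have h1 := hT (T w) w
  have h2 : ‖inner ℂ (T w) (T w)‖ = ‖T w‖ * ‖T w‖ := by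
    rw [inner_self_eq_norm_sq_to_K, norm_pow, sq]
    simp
  rw [h2] at h1
  rcases (norm_nonneg (T w)).eq_or_lt with h0 | h0
  · rw [← h0]
    positivity
  · refine le_of_mul_le_mul_left (h1.trans_eq ?_) h0
    ring

theorem normResolventTendsto (h : IsTubeWidth γ K a) (hW : IsBoundedProfile W C) :
    NormResolventTendsto (fun ε : ℝ => schrodinger (scaledPotential W γ ε)) (𝓝[>] 0)
      (deltaOperator (∫ t in (-1 : ℝ)..1, W t) γ) := by
  classical
  set α := ∫ t in (-1 : ℝ)..1, W t
  let B : ℝ → H1 →L[ℂ] H1 := fun ε =>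
    if hε : 0 < ε ∧ ε ≤ a then ((h.mono hε.1 hε.2).isBoundedPotential hW).form else 0
  have hsmall : ∀ᶠ ε in 𝓝[>] (0 : ℝ), 0 < ε ∧ ε ≤ a := by
    filter_upwards [Ioc_mem_nhdsGT h.pos] with ε hε using hε
  have hB : ∀ ε (hε : 0 < ε ∧ ε ≤ a),
      B ε = ((h.mono hε.1 hε.2).isBoundedPotential hW).form := fun ε hε => dif_pos hε
  refine normResolventTendsto_of_forms (B := B) (h.isFormOperator_deltaOperator α) ?_
    (h.isSelfAdjoint_deltaForm α) ?_
    (fun z hz => isUnit_shiftedForm (h.isSelfAdjoint_deltaForm α) (h.norm_inner_deltaForm_le α) hz)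
    ?_
  · filter_upwards [hsmall] with ε hε
    rw [hB ε hε]
    exact IsBoundedPotential.isFormOperator_schrodinger _
  · filter_upwards [hsmall] with ε hε
    rw [hB ε hε]
    exact IsBoundedPotential.isSelfAdjoint_form _
  · refine (tendsto_iff_norm_sub_tendsto_zero (E := H1 →L[ℂ] H1)).2 ?_
    have hlim := (tendsto_rate K a).const_mul (2 * C)
    rw [mul_zero] at hlim
    refine tendsto_of_tendsto_of_tendsto_of_le_of_le' tendsto_const_nhds hlim
      (Eventually.of_forall fun ε => norm_nonneg (B ε - h.deltaForm α)) ?_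
    filter_upwards [hsmall] with ε hε
    rw [hB ε hε]
    exact h.norm_form_sub_le hW hε.1 hε.2

end IsTubeWidth

end LeakyWire

end

theorem theorem4p1 (γ : ℝ → LeakyWire.Plane) (hγ : LeakyWire.IsRegularCurve γ)
    (W : ℝ → ℝ) (hW : MemLp W ⊤ (volume.restrict (Set.Ioo (-1 : ℝ) 1))) :
    LeakyWire.NormResolventTendsto
      (fun ε : ℝ => LeakyWire.schrodinger (LeakyWire.scaledPotential W γ ε)) (𝓝[>] 0)
      (LeakyWire.deltaOperator (∫ t in (-1 : ℝ)..1, W t) γ) := by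
  obtain ⟨K, a, h⟩ := hγ.exists_isTubeWidth
  obtain ⟨C, hC⟩ := LeakyWire.exists_isBoundedProfile hW
  exact h.normResolventTendsto hC
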